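/- Let $n\ge 2$ and let $f=f^{(0)}+f^{(1)}+\cdots+f^{(m)}$ be a polynomial vector field on $\mathbb C^n$, each $f^{(i)}$ homogeneous of degree $i$, $f^{(m)}\neq 0$. For a polynomial vector field $p$ put $X_p(\psi)=\sum_i p_i\,\partial\psi/\partial x_i$; a nonconstant polynomial $\psi$ is a semi-invariant of $p$ if $X_p(\psi)=\lambda\psi$ for some polynomial $\lambda$. For $v\in\mathbb C^n\setminus\{0\}$ and an invertible matrix $T$ with $Tv=e_1$, write $h=T\circ f\circ T^{-1}$ and let $g_i(x_1,\dots,x_{n+1})=\sum_{j=0}^m h_i^{(j)}(x_1,\dots,x_n)\,x_{n+1}^{m-j}$ for $1\le i\le n$, and $g_{n+1}=0$; the Poincaré transform $f_v^*$ is the vector field in the $n$ variables $x_2,\dots,x_{n+1}$ with components $-g_1(1,x_2,\dots,x_{n+1})\,x_i+g_i(1,x_2,\dots,x_{n+1})$, $2\le i\le n+1$. (Up to linear conjugation it does not depend on $T$.) Property E: for every $v\ne0$ such that $0$ is a stationary point of $f^*_v$, the eigenvalues $\lambda_1,\dots,\lambda_n$ of $Df_v^*(0)$ (with multiplicity) either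 are linearly independent over $\mathbb Q$, or span a $\mathbb Q$-vector space of dimension $n-1$ and satisfy $\sum_i m_i\lambda_i=0$ for some positive integers $m_1,\dots,m_n$. Property S: every homogeneous variety $Y\subsetneq\mathbb C^n$ (common zero set of homogeneous polynomials) with $\dim Y\ge1$ that is invariant for $\dot x=f^{(m)}(x)$ contains a subspace $\mathbb Cv$, $v\ne 0$, that is invariant for $\dot x=f^{(m)}(x)$. (A set is invariant if every solution starting in it remains in it.) Theorem. Let $f$ satisfy properties E and S, and let $\phi_1,\dots,\phi_s$ be irreducible and pairwise relatively prime semi-invariants of $f$, with $r_i=\deg\phi_i$ and with highest degree parts $\phi_i^{(r_i)}$. (a) Let $\psi_1,\dots,\psi_\ell$ be the pairwise relatively prime irreducible factors (up to nonzero constants) of the $\phi_i^{(r_i)}$, $1\le i\le s$. They are homogeneous and are semi-invariants of $f^{(m)}$, there are representations $\phi_i^{(r_i)}=c_i\prod_{j=1}^\ell\psi_j^{k_{ij}}$ with $k_{ij}\ge0$ and nonzero constants $c_i$, and for all such representations $\sum_{i=1}^s k_{ij}\le 1$ for all $j$. Thus every $\psi_j$ divides at most one of the $\phi_i^{(r_i)}$,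 and if it divides one then with exponent $1$. (b) If $f^{(m)}$ admits, up to multiplication by nonzero constants, only finitely many irreducible semi-invariants, and $\psi_1,\dots,\psi_\ell$ lists them without repetition (up to constants), then there are again representations $\phi_i^{(r_i)}=c_i\prod_{j=1}^\ell\psi_j^{k_{ij}}$ with $k_{ij}\ge0$, $c_i\neq0$ constant; for all such representations $\deg\phi_i=\sum_{j=1}^\ell k_{ij}\deg\psi_j$ for $1\le i\le s$; and $$\sum_{i=1}^s\deg\phi_i\le\sum_{j=1}^\ell\deg\psi_j .$$ In particular, $f$ has, up to multiplication by nonzero constants, only finitely many irreducible semi-invariants. -/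

import Mathlib

open MvPolynomial

noncomputable section

namespace PolyVF

/-- A polynomial vector field on `ℂⁿ`, given by its `n` component polynomials. -/
abbrev VField (n : ℕ) : Type := Fin n → MvPolynomial (Fin n) ℂ

/-- The homogeneous part `f^{(j)}` of degree `j` of a polynomial vector field. -/
def homPart {n : ℕ} (j : ℕ) (f : VField n) : VField n :=
  fun i => homogeneousComponent j (f i)

/-- `f = f^{(0)} + ⋯ + f^{(m)}` with `f^{(m)} ≠ 0`. -/
def HasDegree {n : ℕ} (f : VField n) (m : ℕ) : Prop :=
  (∀ i, (f i).totalDegree ≤ m) ∧ homPart m f ≠ 0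

/-- The Lie derivative `X_f(ψ) = ∑ᵢ fᵢ ∂ψ/∂xᵢ`. -/
def lieDeriv {n : ℕ} (f : VField n) (ψ : MvPolynomial (Fin n) ℂ) : MvPolynomial (Fin n) ℂ :=
  ∑ i, f i * pderiv i ψ

/-- `ψ` is a semi-invariant of `f`: it is nonconstant and `X_f(ψ) = L · ψ` for some polynomial
`L` (the cofactor). -/
def IsSemiInvariant {n : ℕ} (f : VField n) (ψ : MvPolynomial (Fin n) ℂ) : Prop :=
  (∀ c : ℂ, ψ ≠ C c) ∧ ∃ L : MvPolynomial (Fin n) ℂ, lieDeriv f ψ = L * ψ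

/-- The highest degree homogeneous part `φ^{(r)}`, `r = deg φ`. -/
def topPart {n : ℕ} (φ : MvPolynomial (Fin n) ℂ) : MvPolynomial (Fin n) ℂ :=
  homogeneousComponent φ.totalDegree φ

/-! ### Poincaré transforms -/

/-- Homogenization `∑_{j ≤ m} q^{(j)}(x₁,…,xₙ) x_{n+1}^{m-j}` to degree `m` of a polynomial `q`
of degree at most `m`; the variable `x_{n+1}` has index `Fin.last n`. -/
def homogenizePoly {n : ℕ} (m : ℕ) (q : MvPolynomial (Fin n) ℂ) : MvPolynomial (Fin (n + 1)) ℂ :=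
  ∑ j ∈ Finset.range (m + 1),
    rename Fin.castSucc (homogeneousComponent j q) * X (Fin.last n) ^ (m - j)

/-- Homogenization `(g₁,…,gₙ,0)` of a vector field of degree `m`. -/
def homogenizeVF {n : ℕ} (m : ℕ) (f : VField n) : Fin (n + 1) → MvPolynomial (Fin (n + 1)) ℂ :=
  Fin.snoc (fun i => homogenizePoly m (f i)) 0

/-- The substitution `q(x₁,…,x_{n+1}) ↦ q(1, x₂,…,x_{n+1})`. The variables `x₂,…,x_{n+1}` of the
result are indexed by `Fin n`, with `j : Fin n` standing for the variable of index `j.succ`. -/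
def setFirstOne {n : ℕ} (q : MvPolynomial (Fin (n + 1)) ℂ) : MvPolynomial (Fin n) ℂ :=
  aeval (Fin.cons 1 X : Fin (n + 1) → MvPolynomial (Fin n) ℂ) q

/-- The special Poincaré transform `f*_{e₁}` of a vector field of degree `m`, with components
`-g₁(1,x₂,…,x_{n+1}) xⱼ + gⱼ(1,x₂,…,x_{n+1})` for `2 ≤ j ≤ n+1`, where `g_{n+1} = 0`. -/
def poincareE1 {n : ℕ} (m : ℕ) (f : VField n) : VField n :=
  fun j => -setFirstOne (homogenizeVF m f 0) * X j + setFirstOne (homogenizeVF m f j.succ)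

/-- The vector field `T ∘ f ∘ T⁻¹` for an invertible matrix `T`. -/
def conjugate {n : ℕ} (T : Matrix (Fin n) (Fin n) ℂ) (f : VField n) : VField n :=
  fun i => ∑ j, C (T i j) * aeval (fun k => ∑ l, C (T⁻¹ k l) * X l) (f j)

/-- The Poincaré transform of `f` (of degree `m`) defined with the invertible matrix `T`; it is a
Poincaré transform with respect to `v` when `T v = e₁`. -/
def poincare {n : ℕ} (m : ℕ) (T : Matrix (Fin n) (Fin n) ℂ) (f : VField n) : VField n :=
  poincareE1 m (conjugate T f)

/-- The first standard basis vector of `ℂⁿ`. -/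
def e1 (n : ℕ) : Fin n → ℂ := fun i => if i.val = 0 then 1 else 0

/-- The Jacobian matrix of a polynomial vector field at a point. -/
def jacobianAt {n : ℕ} (f : VField n) (x : Fin n → ℂ) : Matrix (Fin n) (Fin n) ℂ :=
  Matrix.of fun i j => eval x (pderiv j (f i))

/-! ### Property E -/

/-- `μ₁,…,μₙ` are linearly independent over `ℚ`. -/
def EigCondOne {n : ℕ} (μ : Fin n → ℂ) : Prop := LinearIndependent ℚ μ

/-- The `ℚ`-span of `μ₁,…,μₙ` has dimension `n - 1`, and some linear combination of them with
positive integer coefficients vanishes. -/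
def EigCondTwo {n : ℕ} (μ : Fin n → ℂ) : Prop :=
  Module.finrank ℚ (Submodule.span ℚ (Set.range μ)) + 1 = n ∧
    ∃ d : Fin n → ℕ, (∀ i, 0 < d i) ∧ ∑ i, (d i : ℂ) * μ i = 0

/-- The eigenvalues of `B`, listed with multiplicity, satisfy one of the two conditions. -/
def EigCond {n : ℕ} (B : Matrix (Fin n) (Fin n) ℂ) : Prop :=
  ∃ μ : Fin n → ℂ, B.charpoly = ∏ i, (Polynomial.X - Polynomial.C (μ i)) ∧
    (EigCondOne μ ∨ EigCondTwo μ)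

/-- Property E of a vector field of degree `m`: whenever `0` is a stationary point of a Poincaré
transform with respect to some `v ≠ 0`, the linearization there satisfies one of the two eigenvalue
conditions. (Different matrices `T` with `T v = e₁` give linearly conjugate transforms.) -/
def PropertyE {n : ℕ} (f : VField n) (m : ℕ) : Prop :=
  ∀ v : Fin n → ℂ, v ≠ 0 → ∀ T : Matrix (Fin n) (Fin n) ℂ, IsUnit T.det → T.mulVec v = e1 n →
    (∀ i, eval 0 (poincare m T f i) = 0) → EigCond (jacobianAt (poincare m T f) 0)

/-! ### Property S -/

/-- `Y ⊆ ℂⁿ` is invariant for `ẋ = p(x)`: every solution curve, defined on an open interval around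
`0` and starting in `Y` at time `0`, remains in `Y`. -/
def IsInvariantSet {n : ℕ} (p : VField n) (Y : Set (Fin n → ℂ)) : Prop :=
  ∀ (a b : ℝ) (γ : ℝ → Fin n → ℂ), a < 0 → 0 < b →
    (∀ t ∈ Set.Ioo a b, HasDerivAt γ (fun i => eval (γ t) (p i)) t) →
    γ 0 ∈ Y → ∀ t ∈ Set.Ioo a b, γ t ∈ Y

/-- `Y` is the common zero set of a set of homogeneous polynomials. -/
def IsHomogeneousVariety {n : ℕ} (Y : Set (Fin n → ℂ)) : Prop :=
  ∃ Q : Set (MvPolynomial (Fin n) ℂ), (∀ q ∈ Q, ∃ d, q.IsHomogeneous d) ∧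
    Y = {x | ∀ q ∈ Q, eval x q = 0}

/-- The dimension of a variety: the Krull dimension of its coordinate ring. -/
def varietyDim {n : ℕ} (Y : Set (Fin n → ℂ)) : WithBot ℕ∞ :=
  ringKrullDim (MvPolynomial (Fin n) ℂ ⧸ vanishingIdeal ℂ Y)

/-- Property S of a vector field of degree `m`: every proper homogeneous invariant variety of
positive dimension of `f^{(m)}` contains an invariant line `ℂv`, `v ≠ 0`. -/
def PropertyS {n : ℕ} (f : VField n) (m : ℕ) : Prop :=
  ∀ Y : Set (Fin n → ℂ), IsHomogeneousVariety Y → Y ≠ Set.univ →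
    IsInvariantSet (homPart m f) Y → 1 ≤ varietyDim Y →
    ∃ v : Fin n → ℂ, v ≠ 0 ∧ (Submodule.span ℂ {v} : Set (Fin n → ℂ)) ⊆ Y ∧
      IsInvariantSet (homPart m f) (Submodule.span ℂ {v} : Set (Fin n → ℂ))

/-! ### Factorizations of the highest degree parts -/

/-- `ψ₁,…,ψ_ℓ` are, up to nonzero constants and without repetition, the irreducible factors of the
highest degree parts of `φ₁,…,φ_s`. -/
def IsTopFactorList {n s l : ℕ} (φ : Fin s → MvPolynomial (Fin n) ℂ)
    (ψ : Fin l → MvPolynomial (Fin n) ℂ) : Prop :=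
  (∀ j, Irreducible (ψ j)) ∧ (∀ j j', j ≠ j' → IsRelPrime (ψ j) (ψ j')) ∧
    (∀ j, ∃ i, ψ j ∣ topPart (φ i)) ∧
    ∀ χ, Irreducible χ → (∃ i, χ ∣ topPart (φ i)) → ∃ j, Associated χ (ψ j)

/-- `ψ₁,…,ψ_ℓ` are, up to nonzero constants and without repetition, all the irreducible
semi-invariants of `p`. -/
def IsIrredSemiInvariantList {n l : ℕ} (p : VField n)
    (ψ : Fin l → MvPolynomial (Fin n) ℂ) : Prop :=
  (∀ j, Irreducible (ψ j) ∧ IsSemiInvariant p (ψ j)) ∧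
    (∀ j j', j ≠ j' → ¬ Associated (ψ j) (ψ j')) ∧
    ∀ χ, Irreducible χ → IsSemiInvariant p χ → ∃ j, Associated χ (ψ j)

/-- `φᵢ^{(rᵢ)} = cᵢ ∏ⱼ ψⱼ^{kᵢⱼ}` for all `i`, with nonzero constants `cᵢ`. -/
def IsTopFactorization {n s l : ℕ} (φ : Fin s → MvPolynomial (Fin n) ℂ)
    (ψ : Fin l → MvPolynomial (Fin n) ℂ) (k : Fin s → Fin l → ℕ) : Prop :=
  ∀ i, ∃ c : ℂ, c ≠ 0 ∧ topPart (φ i) = C c * ∏ j, ψ j ^ k i j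

end PolyVF

end

/-! Everything rests on one claim (`not_sq_dvd_prod_topPart`): if an irreducible ψ divides some
highest degree part, then ψ² does not divide the product of all the highest degree parts. Granting
it, unique factorization gives Σᵢ kᵢⱼ ≤ 1, summing degrees gives the inequality in (b), and since
every semi-invariant has degree at least 1, finiteness follows.

The claim is proved at infinity. Such a ψ is a homogeneous semi-invariant of f^(m), so its zero cone
is invariant, and property S supplies v ≠ 0 on the cone with f^(m)(v) a multiple of v
(`exists_radial_point`). Hence 0 is stationary for the Poincaré transform at v, and property E
applies there. The homogenized φᵢ, with product P, and the coordinate z of the hyperplane at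
infinity become semi-invariants of the transform, and zP is squarefree. On z = 0, P restricts to the
product of the highest degree parts; were this divisible by ψ², then P = q²S + zW with q(0) = 0.

Locally, property E makes the eigenvalues λᵢ distinct and forces every nontrivial integer relation
between them to have coefficients of one strict sign. In diagonal coordinates the lowest component
of a semi-invariant is then a monomial (`exists_lowest_monomial`), and for a squarefree
semi-invariant this monomial is squarefree (`lowest_exponent_le_one`). For zP this means that z is a
multiple of some xⱼ and that the lowest monomial of P is squarefree and free of xⱼ. It survives
restriction to z = 0, where the square of the lowest component of q, a nonconstant form, divides it:
a contradiction.

Squarefreeness of the lowest monomial x^m of Q is an elimination argument. If mⱼ ≥ 2, take R ≠ 0 in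
the ideal (Q, ∂ⱼQ) free of xⱼ (`exists_eliminant_pderiv`). Factors X_F - c, with c = Σ zᵢλᵢ and zⱼ ≥
mⱼ - 1 ≥ 1, raise the order of the elements of the ideal of Q and its partial derivatives, so a
product of them sends R into any prescribed power of the maximal ideal (`isKilled_jacobian_ideal`).
A lowest monomial of R therefore has one of these weights, and the sign condition makes it divisible
by xⱼ, which is impossible. -/

namespace PolyVF

/-! ### Homogeneous components through the scaling `x ↦ T x` -/

section Scaling

variable {σ τ : Type*}

/-- The substitution `x ↦ T x`, with values in polynomials in `T`. Its coefficients are the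
homogeneous components. -/
noncomputable def scale : MvPolynomial σ ℂ →ₐ[ℂ] Polynomial (MvPolynomial σ ℂ) :=
  aeval fun i => Polynomial.C (X i) * Polynomial.X

theorem scale_monomial (d : σ →₀ ℕ) (c : ℂ) :
    scale (monomial d c) = Polynomial.monomial d.degree (monomial d c) := by
  rw [scale, aeval_monomial, monomial_eq, ← Polynomial.C_mul_X_pow_eq_monomial]
  simp only [mul_pow, Finsupp.prod, Finset.prod_mul_distrib, Polynomial.C_mul, map_prod,
    Polynomial.C_pow, Finset.prod_pow_eq_pow_sum, Finsupp.degree, mul_assoc]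
  rfl

theorem coeff_scale (k : ℕ) (p : MvPolynomial σ ℂ) :
    (scale p).coeff k = homogeneousComponent k p := by
  induction p using MvPolynomial.induction_on' with
  | monomial d c =>
    rw [scale_monomial, Polynomial.coeff_monomial,
      homogeneousComponent_of_mem (isHomogeneous_monomial c rfl)]
    simp only [eq_comm]
  | add p q hp hq => simp [hp, hq]

theorem scale_injective : Function.Injective (scale : MvPolynomial σ ℂ → _) := by
  intro p q h
  ext d
  have := congrArg (fun r => coeff d (Polynomial.coeff r d.degree)) h
  simpa [coeff_scale, coeff_homogeneousComponent] using this

theorem scale_ne_zero {p : MvPolynomial σ ℂ} (hp : p ≠ 0) : scale p ≠ 0 :=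
  (map_ne_zero_iff _ scale_injective).mpr hp

theorem natDegree_scale_le {p : MvPolynomial σ ℂ} {N : ℕ} (h : p.totalDegree ≤ N) :
    (scale p).natDegree ≤ N :=
  Polynomial.natDegree_le_iff_coeff_eq_zero.mpr fun k hk => by
    rw [coeff_scale, homogeneousComponent_eq_zero _ _ (by lia)]

theorem homogeneousComponent_totalDegree_ne_zero {p : MvPolynomial σ ℂ} (hp : p ≠ 0) :
    homogeneousComponent p.totalDegree p ≠ 0 := by
  have hs : p.support.Nonempty := support_nonempty.mpr hp
  obtain ⟨d, hd, hdeg⟩ := Finset.exists_mem_eq_sup p.support hs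
    (fun s => s.sum fun _ e => e)
  intro h
  have := congrArg (coeff d) h
  rw [coeff_homogeneousComponent, if_pos (by exact hdeg.symm), coeff_zero] at this
  exact mem_support_iff.mp hd this

theorem natDegree_scale (p : MvPolynomial σ ℂ) : (scale p).natDegree = p.totalDegree := by
  by_cases hp : p = 0
  · simp [hp]
  refine le_antisymm (natDegree_scale_le le_rfl) (Polynomial.le_natDegree_of_ne_zero ?_)
  rw [coeff_scale]
  exact homogeneousComponent_totalDegree_ne_zero hp

theorem homogeneousComponent_add_mul {p q : MvPolynomial σ ℂ} {a b : ℕ}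
    (hp : p.totalDegree ≤ a) (hq : q.totalDegree ≤ b) :
    homogeneousComponent (a + b) (p * q) =
      homogeneousComponent a p * homogeneousComponent b q := by
  rw [← coeff_scale, map_mul, Polynomial.coeff_mul_add_eq_of_natDegree_le (natDegree_scale_le hp)
    (natDegree_scale_le hq), coeff_scale, coeff_scale]

/-- Under `scale` a homogeneous polynomial becomes a monomial in T. Degree and trailing degree in T
are both additive over a domain, so they coincide for the product only if they coincide for each
factor. -/
theorem isHomogeneous_of_dvd {p q : MvPolynomial σ ℂ} {N : ℕ} (hq : q.IsHomogeneous N)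
    (hq0 : q ≠ 0) (h : p ∣ q) : ∃ d, p.IsHomogeneous d := by
  obtain ⟨w, rfl⟩ := h
  have hp0 := left_ne_zero_of_mul hq0
  have hw0 := right_ne_zero_of_mul hq0
  have hs : scale (p * w) = Polynomial.monomial N (p * w) := by
    ext1 k
    rw [coeff_scale, homogeneousComponent_of_mem hq, Polynomial.coeff_monomial]
    simp only [eq_comm]
  have h1 : (scale p * scale w).natDegree = N := by
    rw [← map_mul, hs, Polynomial.natDegree_monomial_eq _ hq0]
  have h2 : (scale p * scale w).natTrailingDegree = N := by
    rw [← map_mul, hs, Polynomial.natTrailingDegree_monomial hq0]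
  rw [Polynomial.natDegree_mul (scale_ne_zero hp0) (scale_ne_zero hw0)] at h1
  rw [Polynomial.natTrailingDegree_mul (scale_ne_zero hp0) (scale_ne_zero hw0)] at h2
  have h3 := Polynomial.natTrailingDegree_le_natDegree (scale p)
  have h4 := Polynomial.natTrailingDegree_le_natDegree (scale w)
  refine ⟨(scale p).natDegree, ?_⟩
  intro d hd
  by_contra hne
  change ¬Finsupp.weight (fun _ => 1) d = _ at hne
  rw [← Finsupp.degree_eq_weight_one] at hne
  have : homogeneousComponent (Finsupp.degree d) p = 0 := by
    rw [← coeff_scale]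
    rcases lt_or_gt_of_ne hne with hlt | hgt
    · exact Polynomial.coeff_eq_zero_of_lt_natTrailingDegree (by lia)
    · exact Polynomial.coeff_eq_zero_of_natDegree_lt hgt
  have := congrArg (coeff d) this
  rw [coeff_homogeneousComponent, if_pos rfl, coeff_zero] at this
  exact hd this

/-- A substitution by linear forms commutes with taking homogeneous components. -/
theorem homogeneousComponent_aeval {g : σ → MvPolynomial τ ℂ} (hg : ∀ i, (g i).IsHomogeneous 1)
    (k : ℕ) (p : MvPolynomial σ ℂ) :
    homogeneousComponent k (aeval g p) = aeval g (homogeneousComponent k p) := by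
  induction p using MvPolynomial.induction_on' with
  | monomial d c =>
    have h := (isHomogeneous_monomial c (rfl : d.degree = _)).aeval g hg
    rw [one_mul] at h
    rw [homogeneousComponent_of_mem h,
      homogeneousComponent_of_mem (isHomogeneous_monomial c rfl)]
    split_ifs <;> simp
  | add p q hp hq => simp only [map_add, hp, hq]

theorem totalDegree_aeval_le {g : σ → MvPolynomial τ ℂ} (hg : ∀ i, (g i).IsHomogeneous 1)
    (p : MvPolynomial σ ℂ) : (aeval g p).totalDegree ≤ p.totalDegree := by
  conv_lhs => rw [← sum_homogeneousComponent p, map_sum]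
  refine totalDegree_finsetSum_le fun k hk => ?_
  refine ((homogeneousComponent_isHomogeneous k p).aeval g hg).totalDegree_le.trans ?_
  have := Finset.mem_range.mp hk
  lia

/-- A nonzero polynomial has a lowest homogeneous component. -/
theorem exists_lowest_component {p : MvPolynomial σ ℂ} (hp : p ≠ 0) :
    ∃ k, homogeneousComponent k p ≠ 0 ∧ p ∈ idealOfVars σ ℂ ^ k := by
  refine ⟨(scale p).natTrailingDegree, ?_, ?_⟩
  · rw [← coeff_scale]
    exact (Polynomial.coeff_natTrailingDegree_ne_zero).mpr (scale_ne_zero hp)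
  · rw [mem_pow_idealOfVars_iff']
    intro d hd
    have := congrArg (coeff d) (Polynomial.coeff_eq_zero_of_lt_natTrailingDegree hd)
    rwa [coeff_scale, coeff_homogeneousComponent, if_pos rfl, coeff_zero] at this

theorem homogeneousComponent_eq_zero_of_mem_pow {p : MvPolynomial σ ℂ} {k j : ℕ}
    (hp : p ∈ idealOfVars σ ℂ ^ k) (hj : j < k) : homogeneousComponent j p = 0 := by
  rw [mem_pow_idealOfVars_iff'] at hp
  ext d
  rw [coeff_homogeneousComponent, coeff_zero]
  split_ifs with h
  · exact hp d (h ▸ hj)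
  · rfl

theorem homogeneousComponent_mul_of_mem_pow {p q : MvPolynomial σ ℂ} {a b : ℕ}
    (hp : p ∈ idealOfVars σ ℂ ^ a) (hq : q ∈ idealOfVars σ ℂ ^ b) :
    homogeneousComponent (a + b) (p * q) =
      homogeneousComponent a p * homogeneousComponent b q := by
  rw [← coeff_scale, map_mul, Polynomial.coeff_mul,
    Finset.sum_eq_single_of_mem (a, b) (by simp), coeff_scale, coeff_scale]
  rintro ⟨i, j⟩ hij hne
  rw [coeff_scale, coeff_scale]
  have hij := Finset.HasAntidiagonal.mem_antidiagonal.mp hij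
  simp only at hij ⊢
  rcases lt_trichotomy i a with h | h | h
  · rw [homogeneousComponent_eq_zero_of_mem_pow hp h, zero_mul]
  · exact absurd (Prod.ext h (by simp; lia)) hne
  · rw [homogeneousComponent_eq_zero_of_mem_pow hq (by lia), mul_zero]

theorem mem_pow_of_isHomogeneous {p : MvPolynomial σ ℂ} {k : ℕ} (hp : p.IsHomogeneous k) :
    p ∈ idealOfVars σ ℂ ^ k := by
  rw [mem_pow_idealOfVars_iff']
  exact fun d hd => hp.coeff_eq_zero hd.ne

theorem mem_pow_succ_of_homogeneousComponent_eq_zero {p : MvPolynomial σ ℂ} {k : ℕ}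
    (hp : p ∈ idealOfVars σ ℂ ^ k) (h : homogeneousComponent k p = 0) :
    p ∈ idealOfVars σ ℂ ^ (k + 1) := by
  rw [mem_pow_idealOfVars_iff'] at hp ⊢
  intro d hd
  rcases Nat.lt_succ_iff_lt_or_eq.mp hd with hlt | heq
  · exact hp d hlt
  · have := congrArg (coeff d) h
    rwa [coeff_homogeneousComponent, if_pos heq, coeff_zero] at this

theorem sub_C_coeff_zero_mem (p : MvPolynomial σ ℂ) : p - C (coeff 0 p) ∈ idealOfVars σ ℂ := by
  rw [← pow_one (idealOfVars σ ℂ), mem_pow_idealOfVars_iff']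
  intro d hd
  have : d = 0 := by
    rw [← Finsupp.degree_eq_zero_iff]; lia
  simp [this]

end Scaling

/-! ### Lie derivatives -/

section LieDerivative

variable {n : ℕ}

theorem mkDerivation_eq_lieDeriv (f : VField n) (p : MvPolynomial (Fin n) ℂ) :
    mkDerivation ℂ f p = lieDeriv f p := by
  have h : mkDerivation ℂ f = ∑ i, f i • pderiv i := by
    refine derivation_ext fun i => ?_
    have : (∑ j, f j • pderiv (R := ℂ) j) (X i) = ∑ j, (f j • pderiv (R := ℂ) j) (X i) := by
      rw [← Derivation.coeFnAddMonoidHom_apply, map_sum, Finset.sum_apply]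
      rfl
    rw [mkDerivation_X, this]
    simp [pderiv_X, Pi.single_apply]
  rw [h, ← Derivation.coeFnAddMonoidHom_apply, map_sum, Finset.sum_apply]
  rfl

theorem lieDeriv_X (f : VField n) (i : Fin n) : lieDeriv f (X i) = f i := by
  rw [← mkDerivation_eq_lieDeriv, mkDerivation_X]

theorem lieDeriv_C (f : VField n) (c : ℂ) : lieDeriv f (C c) = 0 := by
  simp [lieDeriv]

theorem lieDeriv_add (f : VField n) (p q : MvPolynomial (Fin n) ℂ) :
    lieDeriv f (p + q) = lieDeriv f p + lieDeriv f q := by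
  simp only [← mkDerivation_eq_lieDeriv, map_add]

theorem lieDeriv_mul (f : VField n) (p q : MvPolynomial (Fin n) ℂ) :
    lieDeriv f (p * q) = p * lieDeriv f q + q * lieDeriv f p := by
  simp only [← mkDerivation_eq_lieDeriv, Derivation.leibniz, smul_eq_mul]

/-- Naturality of derivations under algebra homomorphisms: it suffices to check variables. -/
theorem derivation_comp_of_X {σ τ : Type*} (e : MvPolynomial σ ℂ →ₐ[ℂ] MvPolynomial τ ℂ)
    (D : Derivation ℂ (MvPolynomial σ ℂ) (MvPolynomial σ ℂ))
    (D' : Derivation ℂ (MvPolynomial τ ℂ) (MvPolynomial τ ℂ))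
    (h : ∀ i, D' (e (X i)) = e (D (X i))) (p : MvPolynomial σ ℂ) : D' (e p) = e (D p) := by
  induction p using MvPolynomial.induction_on with
  | C a => simp [derivation_C, algHom_C]
  | add p q hp hq => simp [hp, hq]
  | mul_X p i hp => simp [hp, h]

theorem dvd_lieDeriv_mul {f : VField n} {p q : MvPolynomial (Fin n) ℂ} (hp : p ∣ lieDeriv f p)
    (hq : q ∣ lieDeriv f q) : p * q ∣ lieDeriv f (p * q) := by
  rw [lieDeriv_mul]
  exact dvd_add (mul_dvd_mul_left _ hq) (by rw [mul_comm]; exact mul_dvd_mul_left _ hp)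

theorem dvd_lieDeriv_prod {ι : Type*} {f : VField n} (s : Finset ι)
    {p : ι → MvPolynomial (Fin n) ℂ} (hp : ∀ i, p i ∣ lieDeriv f (p i)) :
    ∏ i ∈ s, p i ∣ lieDeriv f (∏ i ∈ s, p i) := by
  classical
  induction s using Finset.induction_on with
  | empty => simp
  | insert a s ha ih =>
    rw [Finset.prod_insert ha]
    exact dvd_lieDeriv_mul (hp a) ih

/-- Prime factors of a semi-invariant polynomial are semi-invariant. -/
theorem dvd_lieDeriv_of_irreducible_dvd {f : VField n} {p q : MvPolynomial (Fin n) ℂ} (hq : q ≠ 0)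
    (hdq : q ∣ lieDeriv f q) (hp : Irreducible p) (h : p ∣ q) : p ∣ lieDeriv f p := by
  have hpr := hp.prime
  obtain ⟨k, w, hw, rfl⟩ := WfDvdMonoid.max_power_factor hq hp
  cases k with
  | zero => exact absurd (by simpa using h) hw
  | succ k =>
    have h1 : p ^ (k + 1) ∣ w * lieDeriv f (p ^ (k + 1)) := by
      have h2 : p ^ (k + 1) ∣ lieDeriv f (p ^ (k + 1) * w) := (dvd_mul_right _ _).trans hdq
      rw [lieDeriv_mul] at h2
      exact (dvd_add_right (dvd_mul_right _ _)).mp h2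
    -- Cancelling p ^ k leaves p dividing w · (k + 1) · X_f(p); p does not divide w, and k + 1 is
    -- invertible in characteristic zero.
    have h3 : lieDeriv f (p ^ (k + 1)) = p ^ k * (C ((k : ℂ) + 1) * lieDeriv f p) := by
      rw [← mkDerivation_eq_lieDeriv, ← mkDerivation_eq_lieDeriv, Derivation.leibniz_pow]
      simp
      ring
    rw [h3, pow_succ, mul_left_comm, mul_dvd_mul_iff_left (pow_ne_zero _ hp.ne_zero)] at h1
    rcases hpr.dvd_or_dvd h1 with h4 | h4
    · exact absurd h4 hw
    rcases hpr.dvd_or_dvd h4 with h5 | h5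
    · exact absurd (isUnit_of_dvd_unit h5 ((Ne.isUnit (by exact_mod_cast k.succ_ne_zero)).map C))
        hp.not_isUnit
    · exact h5

end LieDerivative
end PolyVF

namespace PolyVF

/-! ### Homogenization and dehomogenization with respect to a variable -/

section Homogenization

variable {n : ℕ} (k : Fin (n + 1))

/-- Homogenization to degree `N`, with `X k` as the new variable. -/
noncomputable def homAt (N : ℕ) (p : MvPolynomial (Fin n) ℂ) : MvPolynomial (Fin (n + 1)) ℂ :=
  ∑ j ∈ Finset.range (N + 1), rename k.succAbove (homogeneousComponent j p) * X k ^ (N - j)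

/-- The substitution of a polynomial for `X k`. -/
noncomputable def substAt (c : MvPolynomial (Fin n) ℂ) :
    MvPolynomial (Fin (n + 1)) ℂ →ₐ[ℂ] MvPolynomial (Fin n) ℂ :=
  aeval (k.insertNth c X : Fin (n + 1) → MvPolynomial (Fin n) ℂ)

theorem substAt_X_self (c : MvPolynomial (Fin n) ℂ) : substAt k c (X k) = c := by
  simp [substAt]

theorem substAt_X_succAbove (c : MvPolynomial (Fin n) ℂ) (i : Fin n) :
    substAt k c (X (k.succAbove i)) = X i := by
  simp [substAt]

theorem substAt_rename (c p : MvPolynomial (Fin n) ℂ) :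
    substAt k c (rename k.succAbove p) = p := by
  rw [substAt, aeval_rename]
  have : (k.insertNth c X : Fin (n + 1) → MvPolynomial (Fin n) ℂ) ∘ k.succAbove = X := by
    ext1 i; simp
  rw [this, aeval_X_left_apply]

theorem substAt_one_homAt {N : ℕ} {p : MvPolynomial (Fin n) ℂ} (hp : p.totalDegree ≤ N) :
    substAt k 1 (homAt k N p) = p := by
  simp only [homAt, map_sum, map_mul, substAt_rename, map_pow, substAt_X_self, one_pow, mul_one]
  conv_rhs => rw [← sum_homogeneousComponent p]
  refine (Finset.sum_subset ?_ ?_).symm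
  · intro j hj
    simp only [Finset.mem_range] at hj ⊢
    lia
  · intro j _ hj
    refine homogeneousComponent_eq_zero _ _ ?_
    simp only [Finset.mem_range] at hj
    lia

theorem homAt_isHomogeneous (N : ℕ) (p : MvPolynomial (Fin n) ℂ) :
    (homAt k N p).IsHomogeneous N := by
  refine IsHomogeneous.sum _ _ _ fun j hj => ?_
  have h1 : (rename k.succAbove (homogeneousComponent j p)).IsHomogeneous j :=
    (homogeneousComponent_isHomogeneous j p).rename_isHomogeneous
  have h2 := h1.mul (isHomogeneous_X_pow (R := ℂ) k (N - j))
  rwa [Nat.add_sub_cancel' (by have := Finset.mem_range.mp hj; lia)] at h2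

theorem X_dvd_homAt_sub (N : ℕ) (p : MvPolynomial (Fin n) ℂ) :
    X k ∣ homAt k N p - rename k.succAbove (homogeneousComponent N p) := by
  rw [homAt, Finset.sum_range_succ, Nat.sub_self, pow_zero, mul_one, add_sub_cancel_right]
  refine Finset.dvd_sum fun j hj => Dvd.dvd.mul_left (dvd_pow_self _ ?_) _
  have := Finset.mem_range.mp hj
  lia

theorem not_X_dvd_homAt {N : ℕ} {p : MvPolynomial (Fin n) ℂ} (h : homogeneousComponent N p ≠ 0) :
    ¬ X k ∣ homAt k N p := by
  intro hd
  have h1 := (dvd_sub_right hd).mp (X_dvd_homAt_sub k N p)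
  have h2 := map_dvd (substAt k 0) h1
  rw [substAt_X_self, substAt_rename, zero_dvd_iff] at h2
  exact h h2

theorem eval_smul_of_isHomogeneous {σ : Type*} {N : ℕ} {P : MvPolynomial σ ℂ}
    (hP : P.IsHomogeneous N) (c : ℂ) (x : σ → ℂ) : eval (c • x) P = c ^ N * eval x P := by
  rw [eval_eq, eval_eq, Finset.mul_sum]
  refine Finset.sum_congr rfl fun d hd => ?_
  have h : ∑ i ∈ d.support, d i = N := by
    have := hP (mem_support_iff.mp hd)
    change Finsupp.weight (fun _ => 1) d = _ at this
    rw [← Finsupp.degree_eq_weight_one] at this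
    exact this
  simp only [Pi.smul_apply, smul_eq_mul, mul_pow, Finset.prod_mul_distrib,
    Finset.prod_pow_eq_pow_sum, h]
  ring

theorem eval_substAt (c : MvPolynomial (Fin n) ℂ) (P : MvPolynomial (Fin (n + 1)) ℂ)
    (x : Fin n → ℂ) : eval x (substAt k c P) = eval (k.insertNth (eval x c) x) P := by
  rw [substAt, ← coe_aeval_eq_eval, ← coe_aeval_eq_eval, ← AlgHom.coe_toRingHom]
  simp only [RingHom.coe_coe]
  rw [comp_aeval_apply]
  congr 2
  ext1 i
  refine Fin.succAboveCases k ?_ (fun j => ?_) i <;> simp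

/-- A point with nonzero k-th coordinate is a multiple of a point with k-th coordinate 1, so by
homogeneity `X k * P` vanishes everywhere. Identities between forms of equal degree can thus be
checked after dehomogenizing. -/
theorem eq_zero_of_substAt_one {N : ℕ} {P : MvPolynomial (Fin (n + 1)) ℂ} (hP : P.IsHomogeneous N)
    (h : substAt k 1 P = 0) : P = 0 := by
  have h1 : X k * P = 0 := by
    refine MvPolynomial.funext fun x => ?_
    rw [map_mul, eval_X, map_zero]
    by_cases hx : x k = 0
    · rw [hx, zero_mul]
    · have h2 : eval (k.insertNth 1 (fun i => (x k)⁻¹ * x (k.succAbove i)) : Fin (n + 1) → ℂ) P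
          = 0 := by
        have := eval_substAt k 1 P (fun i => (x k)⁻¹ * x (k.succAbove i))
        rwa [h, map_zero, map_one, eq_comm] at this
      have h3 : x = x k • (k.insertNth 1 (fun i => (x k)⁻¹ * x (k.succAbove i)) :
          Fin (n + 1) → ℂ) := by
        ext1 i
        refine Fin.succAboveCases k ?_ (fun j => ?_) i
        · simp
        · simp [hx]
      rw [h3, eval_smul_of_isHomogeneous hP, h2, mul_zero, mul_zero]
  exact (mul_eq_zero.mp h1).resolve_left (X_ne_zero k)

theorem eq_of_substAt_one {N : ℕ} {P Q : MvPolynomial (Fin (n + 1)) ℂ} (hP : P.IsHomogeneous N)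
    (hQ : Q.IsHomogeneous N) (h : substAt k 1 P = substAt k 1 Q) : P = Q :=
  sub_eq_zero.mp (eq_zero_of_substAt_one k (hP.sub hQ) (by rw [map_sub, h, sub_self]))

/-- A factor whose square divides P becomes a unit at `X k = 1`; being homogeneous, it is a constant
times a power of `X k`, and `X k` does not divide P. -/
theorem squarefree_of_substAt_one {N : ℕ} {P : MvPolynomial (Fin (n + 1)) ℂ}
    (hP : P.IsHomogeneous N) (hX : ¬ X k ∣ P) (h : Squarefree (substAt k 1 P)) :
    Squarefree P := by
  intro p hp
  have hP0 : P ≠ 0 := by rintro rfl; exact hX (dvd_zero _)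
  obtain ⟨d, hd⟩ := isHomogeneous_of_dvd hP hP0 ((dvd_mul_right p p).trans hp)
  have h1 : IsUnit (substAt k 1 p) := h _ (by rw [← map_mul]; exact map_dvd _ hp)
  obtain ⟨c, hc, hc'⟩ := MvPolynomial.isUnit_iff_eq_C_of_isReduced.mp h1
  have h2 : p = C c * X k ^ d := by
    refine eq_of_substAt_one k hd (isHomogeneous_C_mul_X_pow c k d) ?_
    rw [hc', map_mul, map_pow, substAt_X_self, one_pow, mul_one, algHom_C]
    rfl
  cases d with
  | zero => rw [h2, pow_zero, mul_one]; exact hc.map C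
  | succ d =>
    refine absurd ?_ hX
    refine Dvd.dvd.trans ?_ ((dvd_mul_right p p).trans hp)
    rw [h2]
    exact Dvd.dvd.mul_left (dvd_pow_self _ d.succ_ne_zero) _

theorem isRelPrime_X_of_not_dvd {σ : Type*} {i : σ} {p : MvPolynomial σ ℂ} (h : ¬ X i ∣ p) :
    IsRelPrime (X i) p :=
  (Irreducible.isRelPrime_iff_not_dvd (X_prime (i := i)).irreducible).mpr h

theorem squarefree_substAt_one {N : ℕ} {P : MvPolynomial (Fin (n + 1)) ℂ}
    (hP : P.IsHomogeneous N) (h : Squarefree P) : Squarefree (substAt k 1 P) := by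
  intro p hp
  have hP0 : substAt k 1 P ≠ 0 := fun h0 => h.ne_zero (eq_zero_of_substAt_one k hP h0)
  obtain ⟨w, hw⟩ := hp
  have hp0 : p ≠ 0 := by rintro rfl; simp at hw; exact hP0 hw
  set a := p.totalDegree
  set b := w.totalDegree
  have hpa : substAt k 1 (homAt k a p) = p := substAt_one_homAt k le_rfl
  have hwb : substAt k 1 (homAt k b w) = w := substAt_one_homAt k le_rfl
  -- The powers of `X k` bring both sides to the common degree N + 2a + b; at `X k = 1` the equation
  -- reads p²w = P. The homogenization of p is prime to `X k`, so its square divides P.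
  have key : X k ^ N * (homAt k a p * homAt k a p * homAt k b w) = X k ^ (a + a + b) * P := by
    refine eq_of_substAt_one k (N := N + (a + a + b)) ?_ ?_ ?_
    · exact (isHomogeneous_X_pow k N).mul (((homAt_isHomogeneous k a p).mul
        (homAt_isHomogeneous k a p)).mul (homAt_isHomogeneous k b w))
    · rw [add_comm N]
      exact (isHomogeneous_X_pow k _).mul hP
    · simp only [map_mul, map_pow, substAt_X_self, one_pow, one_mul, hpa, hwb, hw]
  have hrel : IsRelPrime (X k) (homAt k a p) :=
    isRelPrime_X_of_not_dvd (not_X_dvd_homAt k (homogeneousComponent_totalDegree_ne_zero hp0))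
  have hdvd : homAt k a p * homAt k a p ∣ X k ^ (a + a + b) * P := by
    rw [← key]
    exact Dvd.dvd.mul_left (dvd_mul_right _ _) _
  have hdvd' : homAt k a p * homAt k a p ∣ P :=
    IsRelPrime.dvd_of_dvd_mul_left ((hrel.mul_right hrel).pow_left).symm hdvd
  rw [← hpa]
  exact (h _ hdvd').map (substAt k 1)

end Homogenization

/-! ### Semi-invariants of the special Poincaré transform -/

section Poincare

variable {n : ℕ}

theorem homogenizePoly_eq_homAt (m : ℕ) (p : MvPolynomial (Fin n) ℂ) :
    homogenizePoly m p = homAt (Fin.last n) m p := by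
  simp only [homogenizePoly, homAt]
  congr!
  ext1 i
  simp

theorem setFirstOne_eq_substAt (p : MvPolynomial (Fin (n + 1)) ℂ) :
    setFirstOne p = substAt 0 1 p := by
  rw [setFirstOne, substAt, Fin.insertNth_zero']

theorem totalDegree_pderiv_le {σ : Type*} (p : MvPolynomial σ ℂ) (i : σ) :
    (pderiv i p).totalDegree ≤ p.totalDegree - 1 := by
  refine Finset.sup_le fun d hd => ?_
  rw [mem_support_iff, coeff_pderiv] at hd
  have h := le_totalDegree (mem_support_iff.mpr (left_ne_zero_of_mul hd))
  change Finsupp.degree _ ≤ _ at h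
  change Finsupp.degree d ≤ _
  rw [map_add, Finsupp.degree_single] at h
  lia

theorem totalDegree_lieDeriv_le {h : VField n} {m : ℕ} (hm : ∀ i, (h i).totalDegree ≤ m)
    (p : MvPolynomial (Fin n) ℂ) : (lieDeriv h p).totalDegree ≤ m + (p.totalDegree - 1) :=
  totalDegree_finsetSum_le fun i _ => (totalDegree_mul _ _).trans
    (add_le_add (hm i) (totalDegree_pderiv_le p i))

/-- Homogenizing the relation X_h(p) = Lp gives a divisibility up to a factor x_{n+1}, which is
prime to the homogenization of p. The chain rule holds at x_{n+1} = 1 because the last component of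
the homogenized field is 0. -/
theorem dvd_lieDeriv_homogenizeVF {h : VField n} {m : ℕ} (hm : ∀ i, (h i).totalDegree ≤ m)
    {p : MvPolynomial (Fin n) ℂ} (hp0 : p ≠ 0) (hp : p ∣ lieDeriv h p) :
    homAt (Fin.last n) p.totalDegree p ∣
      lieDeriv (homogenizeVF m h) (homAt (Fin.last n) p.totalDegree p) := by
  obtain ⟨L, hL⟩ := hp
  set r := p.totalDegree with hr
  set P := homAt (Fin.last n) r p with hPdef
  have hP : P.IsHomogeneous r := homAt_isHomogeneous _ _ _
  have hPp : substAt (Fin.last n) 1 P = p := substAt_one_homAt _ le_rfl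
  have hLdeg : L.totalDegree ≤ m := by
    by_cases hL0 : L = 0
    · simp [hL0]
    · have h1 := totalDegree_lieDeriv_le hm p
      rw [hL, totalDegree_mul_of_isDomain hp0 hL0] at h1
      lia
  have hchain : substAt (Fin.last n) 1 (lieDeriv (homogenizeVF m h) P) = lieDeriv h p := by
    rw [← mkDerivation_eq_lieDeriv, ← mkDerivation_eq_lieDeriv, ← hPp]
    refine (derivation_comp_of_X _ _ _ (fun i => ?_) P).symm
    rw [mkDerivation_X]
    refine Fin.lastCases ?_ (fun j => ?_) i
    · rw [substAt_X_self]
      simp [homogenizeVF]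
    · rw [← Fin.succAbove_last_apply, substAt_X_succAbove, mkDerivation_X,
        Fin.succAbove_last_apply, homogenizeVF, Fin.snoc_castSucc, homogenizePoly_eq_homAt,
        substAt_one_homAt _ (hm j)]
  -- The extra factor x_{n+1} makes up for the degree lost in differentiation, so that both sides of
  -- `key` have degree m + r.
  have hhom : (X (Fin.last n) * lieDeriv (homogenizeVF m h) P).IsHomogeneous (m + r) := by
    rw [lieDeriv, Finset.mul_sum]
    refine IsHomogeneous.sum _ _ _ fun i _ => ?_
    rw [mul_left_comm]
    refine IsHomogeneous.mul ?_ ?_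
    · refine Fin.lastCases ?_ (fun j => ?_) i
      · simpa [homogenizeVF] using isHomogeneous_zero _ _ m
      · rw [homogenizeVF, Fin.snoc_castSucc, homogenizePoly_eq_homAt]
        exact homAt_isHomogeneous _ _ _
    · rcases Nat.eq_zero_or_pos r with h0 | h0
      · have : P = C (coeff 0 P) := by
          rw [← homogeneousComponent_zero, homogeneousComponent_eq_self (h0 ▸ hP)]
        rw [this, pderiv_C, mul_zero]
        exact isHomogeneous_zero _ _ _
      · have := (isHomogeneous_X ℂ (Fin.last n)).mul (hP.pderiv (i := i))
        rwa [Nat.add_sub_cancel' h0] at this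
  have key : X (Fin.last n) * lieDeriv (homogenizeVF m h) P = homAt (Fin.last n) m L * P := by
    refine eq_of_substAt_one (Fin.last n) hhom ((homAt_isHomogeneous _ _ _).mul hP) ?_
    rw [map_mul, map_mul, substAt_X_self, one_mul, hchain, hPp, substAt_one_homAt _ hLdeg, hL,
      mul_comm]
  have hrel : IsRelPrime (X (Fin.last n)) P :=
    isRelPrime_X_of_not_dvd (not_X_dvd_homAt _ (homogeneousComponent_totalDegree_ne_zero hp0))
  exact hrel.symm.dvd_of_dvd_mul_left (Dvd.intro_left _ key.symm)

/-- The field x₁g - g₁·x has zero first component on x₁ = 1 and restricts there to the Poincaré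
transform. It preserves the ideal of P: the first summand does by hypothesis, and the multiple of
the Euler field x does by homogeneity. -/
theorem dvd_lieDeriv_poincareE1 {h : VField n} {m N : ℕ} {P : MvPolynomial (Fin (n + 1)) ℂ}
    (hP : P.IsHomogeneous N) (hd : P ∣ lieDeriv (homogenizeVF m h) P) :
    setFirstOne P ∣ lieDeriv (poincareE1 m h) (setFirstOne P) := by
  set g := homogenizeVF m h with hg
  have hD : P ∣ lieDeriv (fun i => -g 0 * X i + X 0 * g i) P := by
    have : lieDeriv (fun i => -g 0 * X i + X 0 * g i) P =
        -g 0 * (∑ i, X i * pderiv i P) + X 0 * lieDeriv g P := by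
      simp only [lieDeriv, add_mul, Finset.sum_add_distrib, Finset.mul_sum, mul_assoc]
    rw [this, hP.sum_X_mul_pderiv]
    exact dvd_add (Dvd.dvd.mul_left (by rw [nsmul_eq_mul]; exact dvd_mul_left _ _) _)
      (Dvd.dvd.mul_left hd _)
  have hchain : lieDeriv (poincareE1 m h) (setFirstOne P) =
      setFirstOne (lieDeriv (fun i => -g 0 * X i + X 0 * g i) P) := by
    simp only [setFirstOne_eq_substAt]
    rw [← mkDerivation_eq_lieDeriv, ← mkDerivation_eq_lieDeriv]
    refine derivation_comp_of_X _ _ _ (fun i => ?_) P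
    rw [mkDerivation_X]
    refine Fin.cases ?_ (fun j => ?_) i
    · rw [substAt_X_self]
      simp [mul_comm]
    · rw [← Fin.succAbove_zero_apply, substAt_X_succAbove, mkDerivation_X, poincareE1]
      simp only [setFirstOne_eq_substAt, map_add, map_mul, map_neg, substAt_X_self, one_mul,
        ← hg, Fin.succAbove_zero_apply]
      rw [← Fin.succAbove_zero_apply, substAt_X_succAbove]
  rw [hchain]
  simp only [setFirstOne_eq_substAt]
  exact map_dvd _ hD

end Poincare
end PolyVF

namespace PolyVF

/-! ### Elimination of a variable from a squarefree polynomial and its derivative -/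

section Elimination

open Polynomial in
-- Gauss's lemma: up to units of the fraction field, a factor may be replaced by a primitive
-- polynomial over B, for which divisibility descends to B.
theorem squarefree_map_fractionRing {B : Type*} [CommRing B] [IsDomain B]
    [UniqueFactorizationMonoid B] {q : B[X]} (hq : Squarefree q) :
    Squarefree (q.map (algebraMap B (FractionRing B))) := by
  classical
  let _ : StrongNormalizationMonoid B := UniqueFactorizationMonoid.strongNormalizationMonoid
  let _ : NormalizedGCDMonoid B := UniqueFactorizationMonoid.toNormalizedGCDMonoid B
  set K := FractionRing B
  have hinj : Function.Injective (algebraMap B K) := IsFractionRing.injective B K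
  intro p hp
  have hq0 : q.map (algebraMap B K) ≠ 0 := (Polynomial.map_ne_zero_iff hinj).mpr hq.ne_zero
  have hp0 : p ≠ 0 := by
    rintro rfl
    rw [mul_zero, zero_dvd_iff] at hp
    exact hq0 hp
  set u := (IsLocalization.integerNormalization (nonZeroDivisors B) p) with hu
  obtain ⟨b, hb, hbp⟩ := IsLocalization.integerNormalization_spec (nonZeroDivisors B) p
  have hu0 : u ≠ 0 := fun h => hp0 (IsFractionRing.integerNormalization_eq_zero_iff.mp h)
  have hassoc : Associated (u.primPart.map (algebraMap B K)) p := by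
    have h1 : Associated (u.map (algebraMap B K)) p := by
      rw [hu, hbp, Algebra.smul_def]
      refine associated_unit_mul_left _ _ ?_
      rw [Polynomial.algebraMap_apply, Polynomial.isUnit_C]
      have : algebraMap B K b ≠ 0 := by
        rw [Ne, FaithfulSMul.algebraMap_eq_zero_iff]
        exact nonZeroDivisors.ne_zero hb
      exact this.isUnit
    refine Associated.trans ?_ h1
    conv_rhs => rw [u.eq_C_content_mul_primPart]
    rw [Polynomial.map_mul, Polynomial.map_C]
    refine associated_unit_mul_right _ _ ?_
    rw [Polynomial.isUnit_C]
    have : algebraMap B K u.content ≠ 0 := by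
      rw [Ne, FaithfulSMul.algebraMap_eq_zero_iff, Polynomial.content_eq_zero_iff]
      exact hu0
    exact this.isUnit
  have hqprim : q.map (algebraMap B K) ∣ q.primPart.map (algebraMap B K) := by
    conv_lhs => rw [q.eq_C_content_mul_primPart]
    rw [Polynomial.map_mul, Polynomial.map_C]
    refine (IsUnit.mul_left_dvd ?_).mpr dvd_rfl
    rw [Polynomial.isUnit_C]
    have : algebraMap B K q.content ≠ 0 := by
      rw [Ne, FaithfulSMul.algebraMap_eq_zero_iff, Polynomial.content_eq_zero_iff]
      exact hq.ne_zero
    exact this.isUnit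
  have hprim : (u.primPart * u.primPart).IsPrimitive :=
    u.isPrimitive_primPart.mul u.isPrimitive_primPart
  have h2 : u.primPart * u.primPart ∣ q.primPart := by
    refine hprim.dvd_of_fraction_map_dvd_fraction_map (K := K) ?_
    rw [Polynomial.map_mul]
    exact ((hassoc.mul_mul hassoc).dvd.trans hp).trans hqprim
  have h3 := hq _ (h2.trans q.primPart_dvd)
  exact hassoc.isUnit (h3.map (Polynomial.mapRingHom (algebraMap B K)))

open Polynomial in
-- Over the fraction field, of characteristic zero, squarefree means separable; clearing
-- denominators in the Bézout identity gives r.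
theorem exists_eliminant {B : Type*} [CommRing B] [IsDomain B] [UniqueFactorizationMonoid B]
    [CharZero B] {q : B[X]} (hq : Squarefree q) :
    ∃ a b : B[X], ∃ r : B, r ≠ 0 ∧ a * q + b * derivative q = Polynomial.C r := by
  have hinj : Function.Injective (algebraMap B (FractionRing B)) := IsFractionRing.injective B (FractionRing B)
  have : CharZero (FractionRing B) := charZero_of_injective_algebraMap hinj
  have hsep := PerfectField.separable_iff_squarefree.mpr (squarefree_map_fractionRing hq)
  obtain ⟨a, b, hab⟩ := hsep
  obtain ⟨s, hs, hsa⟩ := IsLocalization.integerNormalization_spec (nonZeroDivisors B) a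
  obtain ⟨t, ht, htb⟩ := IsLocalization.integerNormalization_spec (nonZeroDivisors B) b
  refine ⟨Polynomial.C t * IsLocalization.integerNormalization (nonZeroDivisors B) a,
    Polynomial.C s * IsLocalization.integerNormalization (nonZeroDivisors B) b, s * t,
    mul_ne_zero (nonZeroDivisors.ne_zero hs) (nonZeroDivisors.ne_zero ht), ?_⟩
  apply Polynomial.map_injective _ hinj
  rw [Polynomial.derivative_map] at hab
  simp only [Polynomial.map_add, Polynomial.map_mul, hsa, htb, Polynomial.map_C, map_mul,
    Algebra.smul_def, Polynomial.algebraMap_apply]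
  linear_combination
    (Polynomial.C (algebraMap B (FractionRing B) s) * Polynomial.C (algebraMap B (FractionRing B) t)) * hab

/-- `MvPolynomial` as univariate polynomials in the variable `j`. -/
noncomputable def asPolynomialIn {n : ℕ} (j : Fin n) :
    MvPolynomial (Fin n) ℂ ≃ₐ[ℂ] Polynomial (MvPolynomial {i : Fin n // i ≠ j} ℂ) :=
  (renameEquiv ℂ (Equiv.optionSubtypeNe j).symm).trans (optionEquivLeft ℂ _)

theorem asPolynomialIn_pderiv {n : ℕ} (j : Fin n) (p : MvPolynomial (Fin n) ℂ) :
    asPolynomialIn j (pderiv j p) = Polynomial.derivative (asPolynomialIn j p) := by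
  classical
  induction p using MvPolynomial.induction_on with
  | C a => simp [asPolynomialIn, optionEquivLeft_C]
  | add p q hp hq => simp [hp, hq]
  | mul_X p i hp =>
    have : Polynomial.derivative (asPolynomialIn j (X i)) = asPolynomialIn j (pderiv j (X i)) := by
      by_cases h : i = j
      · subst h
        simp [asPolynomialIn, optionEquivLeft_X_none]
      · rw [pderiv_X_of_ne h]
        simp [asPolynomialIn, Equiv.optionSubtypeNe_symm_of_ne h, optionEquivLeft_X_some]
    rw [pderiv_mul, map_add, map_mul, map_mul, hp, map_mul, Polynomial.derivative_mul, this]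

theorem exists_eliminant_pderiv {n : ℕ} {q : MvPolynomial (Fin n) ℂ} (hq : Squarefree q)
    (j : Fin n) : ∃ a b : MvPolynomial (Fin n) ℂ,
      a * q + b * pderiv j q ≠ 0 ∧ pderiv j (a * q + b * pderiv j q) = 0 := by
  have hq' : Squarefree (asPolynomialIn j q) := by
    intro p hp
    have h1 := map_dvd (asPolynomialIn j).symm hp
    rw [map_mul, AlgEquiv.symm_apply_apply] at h1
    have := (hq _ h1).map (asPolynomialIn j)
    rwa [AlgEquiv.apply_symm_apply] at this
  obtain ⟨a, b, r, hr, hab⟩ := exists_eliminant hq'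
  have key : asPolynomialIn j ((asPolynomialIn j).symm a * q +
      (asPolynomialIn j).symm b * pderiv j q) = Polynomial.C r := by
    rw [map_add, map_mul, map_mul, AlgEquiv.apply_symm_apply, AlgEquiv.apply_symm_apply,
      asPolynomialIn_pderiv, hab]
  refine ⟨(asPolynomialIn j).symm a, (asPolynomialIn j).symm b, ?_, ?_⟩
  · intro h
    rw [h, map_zero, eq_comm, Polynomial.C_eq_zero] at key
    exact hr key
  · apply (asPolynomialIn j).injective
    rw [asPolynomialIn_pderiv, key, Polynomial.derivative_C, map_zero]

end Elimination
end PolyVF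

namespace PolyVF

/-! ### Semi-invariants near a stationary point with diagonal linear part -/

section Local

variable {n : ℕ}

/-- Integer relations between the `lam i` have coefficients of constant strict sign, unless they
are trivial. -/
def SignedRelations (lam : Fin n → ℂ) : Prop :=
  ∀ z : Fin n → ℤ, ∑ i, (z i : ℂ) * lam i = 0 → z = 0 ∨ (∀ i, 0 < z i) ∨ ∀ i, z i < 0

/-- The vector field has linear part `diag(lam)` at `0`. -/
def HasDiagonalPart (F : VField n) (lam : Fin n → ℂ) : Prop :=
  ∀ i, F i - C (lam i) * X i ∈ idealOfVars (Fin n) ℂ ^ 2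

/-- The weight `∑ dᵢ lamᵢ` of an exponent. -/
noncomputable def expWeight (lam : Fin n → ℂ) (d : Fin n →₀ ℕ) : ℂ := ∑ i, (d i : ℂ) * lam i

theorem pderiv_mem_pow {p : MvPolynomial (Fin n) ℂ} {k : ℕ}
    (hp : p ∈ idealOfVars (Fin n) ℂ ^ k) (i : Fin n) :
    pderiv i p ∈ idealOfVars (Fin n) ℂ ^ (k - 1) := by
  rw [mem_pow_idealOfVars_iff'] at hp ⊢
  intro d hd
  rw [coeff_pderiv, hp _ (by rw [map_add, Finsupp.degree_single]; lia), zero_mul]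

theorem coeff_lieDeriv_diagonal (lam : Fin n → ℂ) (p : MvPolynomial (Fin n) ℂ) (d : Fin n →₀ ℕ) :
    coeff d (lieDeriv (fun i => C (lam i) * X i) p) = expWeight lam d * coeff d p := by
  induction p using MvPolynomial.induction_on' with
  | monomial e c =>
    simp only [lieDeriv, mul_assoc, X_mul_pderiv_monomial, coeff_sum, coeff_C_mul, coeff_smul,
      coeff_monomial]
    split_ifs with h
    · subst h
      rw [expWeight, Finset.sum_mul]
      exact Finset.sum_congr rfl fun i _ => by rw [nsmul_eq_mul]; ring
    · simp
  | add p q hp hq => rw [lieDeriv_add, coeff_add, hp, hq, coeff_add, mul_add]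

theorem mul_mem_pow {p q : MvPolynomial (Fin n) ℂ} {a b c : ℕ}
    (hp : p ∈ idealOfVars (Fin n) ℂ ^ a) (hq : q ∈ idealOfVars (Fin n) ℂ ^ b) (h : c ≤ a + b) :
    p * q ∈ idealOfVars (Fin n) ℂ ^ c :=
  Ideal.pow_le_pow_right h (by rw [pow_add]; exact Ideal.mul_mem_mul hp hq)

theorem mem_pow_zero (p : MvPolynomial (Fin n) ℂ) : p ∈ idealOfVars (Fin n) ℂ ^ 0 := by
  simp

variable {F : VField n} {lam : Fin n → ℂ}

/-- The nonlinear part of F raises the order by at least one, so up to degree k only the diagonal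
part acts, and monomials are its eigenvectors. -/
theorem coeff_lieDeriv_of_mem_pow (hF : HasDiagonalPart F lam) {p : MvPolynomial (Fin n) ℂ}
    {k : ℕ} (hp : p ∈ idealOfVars (Fin n) ℂ ^ k) {d : Fin n →₀ ℕ} (hd : d.degree ≤ k) :
    coeff d (lieDeriv F p) = expWeight lam d * coeff d p := by
  have h1 : lieDeriv F p = lieDeriv (fun i => C (lam i) * X i) p +
      ∑ i, (F i - C (lam i) * X i) * pderiv i p := by
    rw [lieDeriv, lieDeriv, ← Finset.sum_add_distrib]
    exact Finset.sum_congr rfl fun i _ => by ring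
  have h2 : ∑ i, (F i - C (lam i) * X i) * pderiv i p ∈ idealOfVars (Fin n) ℂ ^ (k + 1) :=
    Ideal.sum_mem _ fun i _ => mul_mem_pow (hF i) (pderiv_mem_pow hp i) (by lia)
  rw [h1, coeff_add, coeff_lieDeriv_diagonal, (mem_pow_idealOfVars_iff' _ _).mp h2 d (by lia),
    add_zero]

theorem lieDeriv_mem_pow (hF : HasDiagonalPart F lam) {p : MvPolynomial (Fin n) ℂ}
    {k : ℕ} (hp : p ∈ idealOfVars (Fin n) ℂ ^ k) : lieDeriv F p ∈ idealOfVars (Fin n) ℂ ^ k := by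
  rw [mem_pow_idealOfVars_iff']
  intro d hd
  rw [coeff_lieDeriv_of_mem_pow hF hp hd.le, (mem_pow_idealOfVars_iff' _ _).mp hp d hd, mul_zero]

theorem lieDeriv_monomial_sub_mem (hF : HasDiagonalPart F lam) (d : Fin n →₀ ℕ) (c : ℂ) :
    lieDeriv F (monomial d c) - C (expWeight lam d) * monomial d c ∈
      idealOfVars (Fin n) ℂ ^ (d.degree + 1) := by
  have h : monomial d c ∈ idealOfVars (Fin n) ℂ ^ d.degree :=
    mem_pow_of_isHomogeneous (isHomogeneous_monomial c rfl)
  rw [mem_pow_idealOfVars_iff']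
  intro e he
  rw [coeff_sub, coeff_lieDeriv_of_mem_pow hF h (by lia), coeff_C_mul, coeff_monomial]
  split_ifs with h
  · rw [h, sub_self]
  · rw [mul_zero, mul_zero, sub_zero]

/-- The difference d - z is an integer relation, hence zero, strictly positive or strictly negative;
the bound on Σ zᵢ excludes the last case. -/
theorem SignedRelations.exp_le (hlam : SignedRelations lam) {d : Fin n →₀ ℕ} {z : Fin n → ℤ}
    (h : expWeight lam d = ∑ i, (z i : ℂ) * lam i) (hz : ∑ i, z i ≤ d.degree) (i : Fin n) :
    z i ≤ d i := by
  have h1 : ∑ i, ((((d i : ℤ) - z i : ℤ)) : ℂ) * lam i = 0 := by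
    rw [expWeight, ← sub_eq_zero, ← Finset.sum_sub_distrib] at h
    rw [← h]
    exact Finset.sum_congr rfl fun i _ => by push_cast; ring
  rcases hlam _ h1 with h2 | h2 | h2
  · have := congrFun h2 i
    simp only [Pi.zero_apply] at this
    lia
  · have := h2 i
    lia
  · exfalso
    have h3 : ∑ i, (d i : ℤ) < ∑ i, z i :=
      Finset.sum_lt_sum_of_nonempty ⟨i, Finset.mem_univ i⟩ fun i _ => by have := h2 i; lia
    rw [Finsupp.degree_eq_sum] at hz
    push_cast at hz
    lia

/-- The lowest component of a semi-invariant is a monomial, and the constant term of the cofactor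
is its weight. -/
theorem exists_lowest_monomial (hF : HasDiagonalPart F lam) (hlam : SignedRelations lam)
    {Q L : MvPolynomial (Fin n) ℂ} (hQ : Q ≠ 0) (hL : lieDeriv F Q = L * Q) :
    ∃ (d : Fin n →₀ ℕ) (c : ℂ), c ≠ 0 ∧ homogeneousComponent d.degree Q = monomial d c ∧
      Q ∈ idealOfVars (Fin n) ℂ ^ d.degree ∧ coeff 0 L = expWeight lam d := by
  obtain ⟨k, hk, hQk⟩ := exists_lowest_component hQ
  -- Comparing the degree k components of X_F(Q) = LQ shows that every exponent of the lowest
  -- component has weight L(0). Two such exponents have equal degree and weight, so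
  -- `SignedRelations.exp_le` applied in both directions identifies them.
  have hw : ∀ d, coeff d (homogeneousComponent k Q) ≠ 0 →
      d.degree = k ∧ coeff 0 L = expWeight lam d := by
    intro d hd
    have hdk : d.degree = k := by
      by_contra h
      rw [coeff_homogeneousComponent, if_neg h] at hd
      exact hd rfl
    refine ⟨hdk, ?_⟩
    have h1 : homogeneousComponent (0 + k) (L * Q) = _ :=
      homogeneousComponent_mul_of_mem_pow (mem_pow_zero L) hQk
    rw [← hL, zero_add, homogeneousComponent_zero] at h1
    have h2 := congrArg (coeff d) h1
    rw [coeff_C_mul, coeff_homogeneousComponent, if_pos hdk,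
      coeff_lieDeriv_of_mem_pow hF hQk hdk.le] at h2
    rw [coeff_homogeneousComponent, if_pos hdk] at h2 hd
    exact (mul_right_cancel₀ hd h2).symm
  obtain ⟨d, hd⟩ := (MvPolynomial.ne_zero_iff).mp hk
  obtain ⟨hdk, hdw⟩ := hw d hd
  subst hdk
  refine ⟨d, coeff d (homogeneousComponent d.degree Q), hd, ?_, hQk, hdw⟩
  ext e
  rw [coeff_monomial]
  split_ifs with h
  · rw [h]
  · by_contra he
    obtain ⟨hek, hew⟩ := hw e he
    refine h (Finsupp.ext fun i => ?_)
    have key : ∀ a b : Fin n →₀ ℕ, a.degree = b.degree → expWeight lam a = expWeight lam b →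
        b i ≤ a i := fun a b hab hw => by
      have := hlam.exp_le (d := a) (z := fun i => (b i : ℤ)) (by rw [hw]; simp [expWeight])
        (by rw [hab, Finsupp.degree_eq_sum]; push_cast; exact le_rfl) i
      exact_mod_cast this
    exact le_antisymm (key _ _ hek (hew.symm.trans hdw)) (key _ _ hek.symm (hdw.symm.trans hew))

/-- The Lie derivative as an endomorphism. -/
noncomputable def lieEnd (F : VField n) : Module.End ℂ (MvPolynomial (Fin n) ℂ) :=
  (mkDerivation ℂ F).toLinearMap

theorem lieEnd_apply (F : VField n) (p : MvPolynomial (Fin n) ℂ) : lieEnd F p = lieDeriv F p :=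
  mkDerivation_eq_lieDeriv F p

/-- The polynomial `∏ (T - c)` in the Lie derivative. -/
noncomputable def lieProd (F : VField n) (s : Multiset ℂ) :
    Module.End ℂ (MvPolynomial (Fin n) ℂ) :=
  Polynomial.aeval (lieEnd F) (s.map fun c => Polynomial.X - Polynomial.C c).prod

theorem lieProd_add (s t : Multiset ℂ) (p : MvPolynomial (Fin n) ℂ) :
    lieProd F (s + t) p = lieProd F s (lieProd F t p) := by
  simp [lieProd, Module.End.mul_apply]

theorem lieProd_singleton (c : ℂ) (p : MvPolynomial (Fin n) ℂ) :
    lieProd F {c} p = lieDeriv F p - C c * p := by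
  simp [lieProd, lieEnd_apply, Module.algebraMap_end_apply, smul_eq_C_mul]

theorem lieProd_mem_pow (hF : HasDiagonalPart F lam) {k : ℕ} (s : Multiset ℂ)
    {p : MvPolynomial (Fin n) ℂ} (hp : p ∈ idealOfVars (Fin n) ℂ ^ k) :
    lieProd F s p ∈ idealOfVars (Fin n) ℂ ^ k := by
  induction s using Multiset.induction_on with
  | empty => simpa [lieProd] using hp
  | cons c s ih =>
    rw [← Multiset.singleton_add, lieProd_add, lieProd_singleton]
    exact sub_mem (lieDeriv_mem_pow hF ih) (Ideal.mul_mem_left _ _ ih)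

theorem coeff_lieProd (hF : HasDiagonalPart F lam) (s : Multiset ℂ)
    {p : MvPolynomial (Fin n) ℂ} {d : Fin n →₀ ℕ} (hp : p ∈ idealOfVars (Fin n) ℂ ^ d.degree) :
    coeff d (lieProd F s p) = (s.map fun c => expWeight lam d - c).prod * coeff d p := by
  induction s using Multiset.induction_on with
  | empty => simp [lieProd]
  | cons c s ih =>
    rw [← Multiset.singleton_add, lieProd_add, lieProd_singleton, coeff_sub,
      coeff_lieDeriv_of_mem_pow hF (lieProd_mem_pow hF s hp) le_rfl, coeff_C_mul, ih,
      Multiset.map_add, Multiset.prod_add]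
    simp
    ring

/-- `p` is killed modulo `𝔪 ^ (K + 1)` by a product of factors `X_F - c` with `c ∈ G`. -/
def IsKilled (F : VField n) (K : ℕ) (G : Set ℂ) (p : MvPolynomial (Fin n) ℂ) : Prop :=
  ∃ s : Multiset ℂ, (∀ c ∈ s, c ∈ G) ∧ lieProd F s p ∈ idealOfVars (Fin n) ℂ ^ (K + 1)

theorem isKilled_of_mem_pow {K : ℕ} {G : Set ℂ} {p : MvPolynomial (Fin n) ℂ}
    (hp : p ∈ idealOfVars (Fin n) ℂ ^ (K + 1)) : IsKilled F K G p :=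
  ⟨0, by simp, by simpa [lieProd] using hp⟩

theorem IsKilled.add (hF : HasDiagonalPart F lam) {K : ℕ} {G : Set ℂ}
    {p q : MvPolynomial (Fin n) ℂ} (hp : IsKilled F K G p) (hq : IsKilled F K G q) :
    IsKilled F K G (p + q) := by
  obtain ⟨s, hs, hsp⟩ := hp
  obtain ⟨t, ht, htq⟩ := hq
  refine ⟨s + t, fun c hc => (Multiset.mem_add.mp hc).elim (hs c) (ht c), ?_⟩
  rw [map_add, lieProd_add s t q, add_comm s t, lieProd_add t s p]
  exact add_mem (lieProd_mem_pow hF t hsp) (lieProd_mem_pow hF s htq)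

theorem IsKilled.sum (hF : HasDiagonalPart F lam) {K : ℕ} {G : Set ℂ} {ι : Type*} (s : Finset ι)
    {p : ι → MvPolynomial (Fin n) ℂ} (hp : ∀ i ∈ s, IsKilled F K G (p i)) :
    IsKilled F K G (∑ i ∈ s, p i) := by
  classical
  induction s using Finset.induction_on with
  | empty => exact isKilled_of_mem_pow (by simp)
  | insert a s ha ih =>
    rw [Finset.sum_insert ha]
    exact (hp a (Finset.mem_insert_self a s)).add hF
      (ih fun i hi => hp i (Finset.mem_insert_of_mem hi))

theorem IsKilled.of_sub {K : ℕ} {G : Set ℂ} {p : MvPolynomial (Fin n) ℂ} {c : ℂ} (hc : c ∈ G)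
    (h : IsKilled F K G (lieDeriv F p - C c * p)) : IsKilled F K G p := by
  obtain ⟨s, hs, hsp⟩ := h
  refine ⟨s + {c}, fun a ha => ?_, ?_⟩
  · rcases Multiset.mem_add.mp ha with h | h
    · exact hs a h
    · rwa [Multiset.mem_singleton.mp h]
  · rwa [lieProd_add, lieProd_singleton]

/-- To see that the multiples `B * g`, `B ∈ 𝔪 ^ e`, are killed, it suffices to treat monomials
`B` of degree `e` and `B ∈ 𝔪 ^ (e + 1)`. -/
theorem isKilled_mul_of_monomial (hF : HasDiagonalPart F lam) {K e : ℕ} {G : Set ℂ}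
    {g : MvPolynomial (Fin n) ℂ}
    (h1 : ∀ (d : Fin n →₀ ℕ) (c : ℂ), d.degree = e → IsKilled F K G (monomial d c * g))
    (h2 : ∀ B ∈ idealOfVars (Fin n) ℂ ^ (e + 1), IsKilled F K G (B * g))
    {B : MvPolynomial (Fin n) ℂ} (hB : B ∈ idealOfVars (Fin n) ℂ ^ e) :
    IsKilled F K G (B * g) := by
  have hdec : B * g = homogeneousComponent e B * g + (B - homogeneousComponent e B) * g := by ring
  rw [hdec]
  refine IsKilled.add hF ?_ (h2 _ ?_)
  · rw [homogeneousComponent_apply, Finset.sum_mul]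
    exact IsKilled.sum hF _ fun d hd => h1 d _ (Finset.mem_filter.mp hd).2
  · refine mem_pow_succ_of_homogeneousComponent_eq_zero (sub_mem hB
      (mem_pow_of_isHomogeneous (homogeneousComponent_isHomogeneous e B))) ?_
    rw [map_sub, homogeneousComponent_eq_self (homogeneousComponent_isHomogeneous e B), sub_self]

theorem pderiv_lieDeriv (F : VField n) (i : Fin n) (p : MvPolynomial (Fin n) ℂ) :
    pderiv i (lieDeriv F p) = lieDeriv F (pderiv i p) + ∑ j, pderiv i (F j) * pderiv j p := by
  have hcomm : ∀ j, pderiv i (pderiv j p) = pderiv j (pderiv i p) := fun j => by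
    ext d
    simp only [coeff_pderiv, Finsupp.add_apply]
    rw [add_right_comm]
    by_cases hij : i = j
    · subst hij; rfl
    · rw [Finsupp.single_eq_of_ne (Ne.symm hij),
        Finsupp.single_eq_of_ne hij]
      push_cast
      ring
  simp only [lieDeriv, map_sum, pderiv_mul, Finset.sum_add_distrib, hcomm]
  ring

/-- The ideal generated by a semi-invariant `Q` and its partial derivatives, filtered by order, is
killed by factors `X_F - c` with `c` the weights of the lowest terms. -/
theorem isKilled_jacobian_ideal (hF : HasDiagonalPart F lam) {Q L : MvPolynomial (Fin n) ℂ}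
    (hL : lieDeriv F Q = L * Q) {m : Fin n →₀ ℕ} (hQ : Q ∈ idealOfVars (Fin n) ℂ ^ m.degree)
    (hm : coeff 0 L = expWeight lam m) {j : Fin n} (hj : 2 ≤ m j) (K : ℕ) (e : ℕ)
    {A : MvPolynomial (Fin n) ℂ} {B : Fin n → MvPolynomial (Fin n) ℂ}
    (hA : A ∈ idealOfVars (Fin n) ℂ ^ (e - 1)) (hB : ∀ i, B i ∈ idealOfVars (Fin n) ℂ ^ e) :
    IsKilled F K {c | ∃ z : Fin n → ℤ, 1 ≤ z j ∧ ∑ i, z i ≤ K ∧ c = ∑ i, (z i : ℂ) * lam i}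
      (A * Q + ∑ i, B i * pderiv i Q) := by
  set G : Set ℂ := {c | ∃ z : Fin n → ℤ, 1 ≤ z j ∧ ∑ i, z i ≤ K ∧ c = ∑ i, (z i : ℂ) * lam i}
  have hmdeg : m.degree = ∑ i, m i := Finsupp.degree_eq_sum m
  have hm2 : 2 ≤ m.degree := hj.trans (Finsupp.le_degree j m)
  have hL' : L - C (expWeight lam m) ∈ idealOfVars (Fin n) ℂ ^ 1 := by
    rw [← hm, pow_one]; exact sub_C_coeff_zero_mem L
  have hFd : ∀ i k, pderiv i (F k) - C (if k = i then lam k else 0) ∈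
      idealOfVars (Fin n) ℂ ^ 1 := by
    intro i k
    have h1 := pderiv_mem_pow (hF k) i
    rw [map_sub, pderiv_C_mul, pderiv_X] at h1
    convert h1 using 2
    by_cases h : k = i
    · simp [h]
    · simp [h]
  -- Q has order at least |m| and its derivatives at least |m| - 1, so all terms have order at least
  -- e + |m| - 1, which is at least K + 1 in the first case. Otherwise the induction raises e.
  rcases le_or_gt (K + 2) (m.degree + e) with he | he
  · refine isKilled_of_mem_pow (add_mem (mul_mem_pow hA hQ (by lia)) (Ideal.sum_mem _ fun i _ => ?_))
    exact mul_mem_pow (hB i) (pderiv_mem_pow hQ i) (by lia)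
  · have ih : ∀ {A : MvPolynomial (Fin n) ℂ} {B : Fin n → MvPolynomial (Fin n) ℂ},
        A ∈ idealOfVars (Fin n) ℂ ^ e → (∀ i, B i ∈ idealOfVars (Fin n) ℂ ^ (e + 1)) →
        IsKilled F K G (A * Q + ∑ i, B i * pderiv i Q) := fun {A B} hA hB =>
      isKilled_jacobian_ideal hF hL hQ hm hj K (e + 1) hA hB
    have ihA : ∀ A ∈ idealOfVars (Fin n) ℂ ^ e, IsKilled F K G (A * Q) := fun A hA => by
      simpa using ih (B := 0) hA (fun i => zero_mem _)
    have ihB : ∀ i, ∀ B ∈ idealOfVars (Fin n) ℂ ^ (e + 1), IsKilled F K G (B * pderiv i Q) :=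
      fun i B hB => by
        have := ih (A := 0) (B := Pi.single i B) (zero_mem _) (fun k => by
          by_cases h : k = i
          · subst h; simpa using hB
          · simp [h])
        rw [Finset.sum_eq_single i (fun k _ hk => by simp [hk]) (by simp)] at this
        simpa using this
    refine IsKilled.add hF ?_ (IsKilled.sum hF _ fun i _ => ?_)
    · rcases Nat.eq_zero_or_pos e with h0 | h0
      · exact ihA A (by rw [h0]; exact mem_pow_zero A)
      · refine isKilled_mul_of_monomial hF (fun d c hd => ?_) (fun B hB => ihA B ?_) hA
        -- To leading order x^d · Q has weight d + m; here |d| = e - 1, so Σ zᵢ = e - 1 + |m| ≤ K.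
        · refine IsKilled.of_sub (c := expWeight lam d + expWeight lam m)
            ⟨fun i => d i + m i, by lia, ?_, ?_⟩ ?_
          · rw [Finset.sum_add_distrib]
            have := Finsupp.degree_eq_sum d
            zify at this hmdeg
            lia
          · simp only [expWeight, ← Finset.sum_add_distrib]
            exact Finset.sum_congr rfl fun i _ => by push_cast; ring
          · have : lieDeriv F (monomial d c * Q) -
                C (expWeight lam d + expWeight lam m) * (monomial d c * Q) =
                ((lieDeriv F (monomial d c) - C (expWeight lam d) * monomial d c) +
                  monomial d c * (L - C (expWeight lam m))) * Q := by
              rw [lieDeriv_mul, hL, C_add]; ring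
            rw [this]
            refine ihA _ (add_mem ?_ ?_)
            · have := lieDeriv_monomial_sub_mem hF d c
              rwa [hd, Nat.sub_add_cancel h0] at this
            · exact mul_mem_pow (mem_pow_of_isHomogeneous (isHomogeneous_monomial c hd)) hL'
                (by lia)
        · rwa [Nat.sub_add_cancel h0] at hB
    · refine isKilled_mul_of_monomial hF (fun d c hd => ?_) (fun B hB => ihB i B hB) (hB i)
      -- Differentiating by xᵢ lowers the weight by λᵢ, so z = d + m - eᵢ. Its j-th entry is at
      -- least mⱼ - 1 ≥ 1, which is where mⱼ ≥ 2 enters.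
      refine IsKilled.of_sub (c := expWeight lam d + expWeight lam m - lam i)
        ⟨fun k => d k + m k - (if k = i then 1 else 0), by beta_reduce; split_ifs <;> lia, ?_, ?_⟩ ?_
      · rw [Finset.sum_sub_distrib, Finset.sum_add_distrib]
        have := Finsupp.degree_eq_sum d
        zify at this hmdeg
        simp only [Finset.sum_ite_eq', Finset.mem_univ, if_true]
        lia
      · have : ∑ k, (if k = i then (1 : ℂ) else 0) * lam k = lam i := by simp
        simp only [expWeight]
        rw [← this, ← Finset.sum_add_distrib, ← Finset.sum_sub_distrib]
        exact Finset.sum_congr rfl fun k _ => by push_cast; ring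
      · have hd' : monomial d c ∈ idealOfVars (Fin n) ℂ ^ e :=
          mem_pow_of_isHomogeneous (isHomogeneous_monomial c hd)
        have h1 : lieDeriv F (pderiv i Q) = L * pderiv i Q + Q * pderiv i L -
            ∑ k, pderiv i (F k) * pderiv k Q := by
          rw [eq_sub_iff_add_eq, ← pderiv_lieDeriv, hL, pderiv_mul]; ring
        have h2 : ∑ k, pderiv i (F k) * pderiv k Q = C (lam i) * pderiv i Q +
            ∑ k, (pderiv i (F k) - C (if k = i then lam k else 0)) * pderiv k Q := by
          simp only [sub_mul, Finset.sum_sub_distrib]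
          rw [Finset.sum_eq_single (f := fun k => C (if k = i then lam k else 0) * pderiv k Q) i
            (fun k _ hk => by simp [hk]) (by simp)]
          simp
        -- The commutator of ∂ᵢ with X_F contributes -λᵢ from the linear part. The remainder is a
        -- combination of Q with coefficient of order at least e and of the ∂ₖQ with coefficients of
        -- order at least e + 1, as the induction requires.
        have : lieDeriv F (monomial d c * pderiv i Q) -
            C (expWeight lam d + expWeight lam m - lam i) * (monomial d c * pderiv i Q) =
            (monomial d c * pderiv i L) * Q +
            ((lieDeriv F (monomial d c) - C (expWeight lam d) * monomial d c +
                monomial d c * (L - C (expWeight lam m))) * pderiv i Q +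
            ∑ k, (-monomial d c * (pderiv i (F k) - C (if k = i then lam k else 0))) *
              pderiv k Q) := by
          simp only [mul_assoc, ← Finset.mul_sum]
          rw [lieDeriv_mul, h1, h2, C_sub, C_add]
          ring
        rw [this]
        refine IsKilled.add hF (ihA _ (Ideal.mul_mem_right _ _ hd'))
          (IsKilled.add hF (ihB i _ (add_mem ?_ ?_)) (IsKilled.sum hF _ fun k _ => ihB k _ ?_))
        · have := lieDeriv_monomial_sub_mem hF d c
          rwa [hd] at this
        · exact mul_mem_pow hd' hL' le_rfl
        · exact mul_mem_pow (neg_mem hd') (hFd i k) le_rfl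
termination_by K + 2 - e

/-- The lowest monomial of a squarefree semi-invariant is squarefree. -/
theorem lowest_exponent_le_one (hF : HasDiagonalPart F lam) (hlam : SignedRelations lam)
    {Q L : MvPolynomial (Fin n) ℂ} (hsq : Squarefree Q) (hL : lieDeriv F Q = L * Q)
    {m : Fin n →₀ ℕ} (hQ : Q ∈ idealOfVars (Fin n) ℂ ^ m.degree)
    (hm : coeff 0 L = expWeight lam m) (j : Fin n) : m j ≤ 1 := by
  by_contra hj
  obtain ⟨a, b, hR0, hRj⟩ := exists_eliminant_pderiv hsq j
  set R := a * Q + b * pderiv j Q with hR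
  obtain ⟨K, hK, hRK⟩ := exists_lowest_component hR0
  -- At e = 0 the coefficients a and b are unrestricted. K is the order of R, so the degree K
  -- coefficients of R must be killed.
  have hkill := isKilled_jacobian_ideal hF hL hQ hm (j := j) (by lia) K 0 (A := a)
    (B := Pi.single j b) (mem_pow_zero a) (fun i => mem_pow_zero _)
  rw [Finset.sum_eq_single j (fun k _ hk => by simp [hk]) (by simp), Pi.single_eq_same, ← hR]
    at hkill
  obtain ⟨s, hs, hsR⟩ := hkill
  obtain ⟨d, hd⟩ := (MvPolynomial.ne_zero_iff).mp hK
  have hdK : d.degree = K := by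
    by_contra h
    rw [coeff_homogeneousComponent, if_neg h] at hd
    exact hd rfl
  rw [coeff_homogeneousComponent, if_pos hdK] at hd
  have h1 := (mem_pow_idealOfVars_iff' _ _).mp hsR d (by lia)
  rw [coeff_lieProd hF s (hdK ▸ hRK), mul_eq_zero, or_iff_left hd, Multiset.prod_eq_zero_iff,
    Multiset.mem_map] at h1
  obtain ⟨c, hc, hdc⟩ := h1
  obtain ⟨z, hzj, hzK, rfl⟩ := hs c hc
  have hdj := hlam.exp_le (sub_eq_zero.mp hdc) (by rw [hdK]; exact hzK) j
  -- Since dⱼ ≥ zⱼ ≥ 1, the monomial x^d of R contributes the nonzero coefficient dⱼ · coeff d R to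
  -- ∂ⱼR, which is 0.
  have h2 := congrArg (coeff (d - Finsupp.single j 1)) hRj
  have hle : Finsupp.single j 1 ≤ d := by
    rw [Finsupp.single_le_iff]; lia
  rw [coeff_pderiv, tsub_add_cancel_of_le hle, coeff_zero, mul_eq_zero, or_iff_right hd] at h2
  have h3 : (((d - Finsupp.single j 1 : Fin n →₀ ℕ) j + 1 : ℕ) : ℂ) = 0 := by
    push_cast; exact h2
  exact absurd (Nat.cast_eq_zero.mp h3) (Nat.succ_ne_zero _)

end Local
end PolyVF

namespace PolyVF

/-! ### The local obstruction in diagonal coordinates -/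

section LocalObstruction

variable {n : ℕ}

theorem squarefree_monomial {d : Fin n →₀ ℕ} {c : ℂ} (hc : c ≠ 0) (hd : ∀ i, d i ≤ 1) :
    Squarefree (monomial d c) := by
  rw [monomial_eq, Finsupp.prod_fintype _ _ (by simp)]
  refine (Associated.squarefree_iff (associated_unit_mul_left _ _ (hc.isUnit.map C))).mpr ?_
  refine Finset.squarefree_prod_of_pairwise_isCoprime (fun i _ j _ hij => ?_) fun i _ => ?_
  · have h : IsRelPrime (X i : MvPolynomial (Fin n) ℂ) (X j) := by
      refine isRelPrime_X_of_not_dvd ?_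
      rw [X_dvd_X]
      simpa using hij
    exact h.pow
  · rcases Nat.le_one_iff_eq_zero_or_eq_one.mp (hd i) with h | h
    · rw [h, pow_zero]; exact squarefree_one
    · rw [h, pow_one]; exact (X_prime (i := i)).irreducible.squarefree

/-- If zP were squarefree, its lowest monomial would be squarefree, so the lowest monomial of P
would be squarefree and prime to z, hence unchanged on z = 0. There P equals q²S, and the lowest
component of q has positive degree. -/
theorem not_squarefree_of_diagonal {F : VField n} {lam : Fin n → ℂ} (hF : HasDiagonalPart F lam)
    (hlam : SignedRelations lam) {z P q S W : MvPolynomial (Fin n) ℂ}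
    (hz : z ∣ lieDeriv F z) (hz1 : z.IsHomogeneous 1) (hP : P ∣ lieDeriv F P)
    (hPq : P = q * q * S + z * W) (hq : eval 0 q = 0) : ¬ Squarefree (z * P) := by
  intro hsq
  have hz0 : z ≠ 0 := left_ne_zero_of_mul hsq.ne_zero
  have hP0 : P ≠ 0 := right_ne_zero_of_mul hsq.ne_zero
  obtain ⟨Lz, hLz⟩ := hz
  obtain ⟨L, hL⟩ := hP
  rw [mul_comm] at hLz hL
  obtain ⟨dz, cz, hcz, hdz, hzmem, hwz⟩ := exists_lowest_monomial hF hlam hz0 hLz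
  obtain ⟨d, c, hc, hd, hPmem, hw⟩ := exists_lowest_monomial hF hlam hP0 hL
  -- A linear form is its own lowest component, so z is a constant multiple of a single variable xⱼ.
  have hdz1 : dz.degree = 1 := by
    by_contra h
    rw [homogeneousComponent_of_mem hz1, if_neg h, eq_comm, monomial_eq_zero] at hdz
    exact hcz hdz
  rw [hdz1, homogeneousComponent_eq_self hz1] at hdz
  obtain ⟨j, rfl⟩ : ∃ j, dz = Finsupp.single j 1 := by
    have h : dz ∈ {d : Fin n →₀ ℕ | d.degree = 1} := hdz1
    rw [← Finsupp.range_single_one] at h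
    obtain ⟨j, hj⟩ := h
    exact ⟨j, hj.symm⟩
  have hLzP : lieDeriv F (z * P) = (Lz + L) * (z * P) := by
    rw [lieDeriv_mul, hLz, hL]; ring
  have hle := lowest_exponent_le_one hF hlam hsq hLzP (m := Finsupp.single j 1 + d)
    (by rw [map_add]; exact mul_mem_pow hzmem hPmem le_rfl)
    (by
      rw [coeff_add, hwz, hw]
      simp only [expWeight, ← Finset.sum_add_distrib]
      exact Finset.sum_congr rfl fun i _ => by
        rw [Finsupp.add_apply]; push_cast; ring)
  have hdj : d j = 0 := by have := hle j; simp at this; lia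
  have hd1 : ∀ i, d i ≤ 1 := fun i => by
    have := hle i; rw [Finsupp.add_apply] at this; lia
  -- The substitution xⱼ = 0, that is, restriction to z = 0.
  set g : Fin n → MvPolynomial (Fin n) ℂ := fun i => if i = j then 0 else X i with hg
  have hg1 : ∀ i, (g i).IsHomogeneous 1 := fun i => by
    simp only [hg]
    split_ifs
    · exact isHomogeneous_zero _ _ _
    · exact isHomogeneous_X _ _
  have hgz : aeval g z = 0 := by
    rw [hdz, aeval_monomial, Finsupp.prod_single_index (by simp)]
    simp [hg]
  have hgP : aeval g P = aeval g q * aeval g q * aeval g S := by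
    rw [hPq, map_add, map_mul, map_mul, map_mul, hgz, zero_mul, add_zero]
  have hlow : homogeneousComponent d.degree (aeval g P) = monomial d c := by
    rw [homogeneousComponent_aeval hg1, hd, aeval_monomial, monomial_eq]
    congr 1
    refine Finsupp.prod_congr fun i hi => ?_
    have : i ≠ j := by rintro rfl; exact (Finsupp.mem_support_iff.mp hi) hdj
    simp [hg, this]
  have hne : aeval g P ≠ 0 := by
    intro h
    rw [h, map_zero, eq_comm, monomial_eq_zero] at hlow
    exact hc hlow
  rw [hgP] at hne
  have hq0 := left_ne_zero_of_mul (left_ne_zero_of_mul hne)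
  obtain ⟨a, ha, hqa⟩ := exists_lowest_component hq0
  obtain ⟨b, hb, hSb⟩ := exists_lowest_component (right_ne_zero_of_mul hne)
  have hqq : aeval g q * aeval g q ∈ idealOfVars (Fin n) ℂ ^ (a + a) := mul_mem_pow hqa hqa le_rfl
  have hcomp : homogeneousComponent (a + a + b) (aeval g P) =
      homogeneousComponent a (aeval g q) * homogeneousComponent a (aeval g q) *
        homogeneousComponent b (aeval g S) := by
    rw [hgP, homogeneousComponent_mul_of_mem_pow hqq hSb,
      homogeneousComponent_mul_of_mem_pow hqa hqa]
  -- Both are the order of the restriction of P to z = 0, so its lowest component x^d is the product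
  -- of the lowest components of q, q and S.
  have hdeg : a + a + b = d.degree := by
    refine le_antisymm ?_ ?_
    · by_contra h
      have h1 : aeval g P ∈ idealOfVars (Fin n) ℂ ^ (a + a + b) := by
        rw [hgP]; exact mul_mem_pow hqq hSb le_rfl
      rw [homogeneousComponent_eq_zero_of_mem_pow h1 (not_le.mp h), eq_comm, monomial_eq_zero]
        at hlow
      exact hc hlow
    · by_contra h
      have h1 := homogeneousComponent_aeval hg1 (a + a + b) P
      rw [homogeneousComponent_eq_zero_of_mem_pow hPmem (not_le.mp h), map_zero, hcomp] at h1
      exact mul_ne_zero (mul_ne_zero ha ha) hb h1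
  rw [hdeg, hlow] at hcomp
  have hunit := squarefree_monomial hc hd1 _ ⟨_, hcomp⟩
  obtain ⟨u, -, hu⟩ := MvPolynomial.isUnit_iff_eq_C_of_isReduced.mp hunit
  have ha0 : a ≠ 0 := by
    rintro rfl
    rw [homogeneousComponent_aeval hg1, homogeneousComponent_zero, ← constantCoeff_eq, ← eval_zero,
      hq, C_0, map_zero] at ha
    exact ha rfl
  have h1 : (C u : MvPolynomial (Fin n) ℂ).IsHomogeneous a :=
    hu ▸ homogeneousComponent_isHomogeneous a _
  exact ha0 (h1.inj_right (isHomogeneous_C _ u) (hu ▸ ha))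

end LocalObstruction

/-! ### Linear changes of coordinates -/

section Linear

variable {n : ℕ}

/-- The substitution `x ↦ M x`. -/
noncomputable def linSub (M : Matrix (Fin n) (Fin n) ℂ) :
    MvPolynomial (Fin n) ℂ →ₐ[ℂ] MvPolynomial (Fin n) ℂ :=
  aeval fun k => ∑ l, C (M k l) * X l

theorem isHomogeneous_linForm (M : Matrix (Fin n) (Fin n) ℂ) (k : Fin n) :
    (∑ l, C (M k l) * X l : MvPolynomial (Fin n) ℂ).IsHomogeneous 1 :=
  IsHomogeneous.sum _ _ _ fun _ _ => isHomogeneous_C_mul_X _ _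

theorem linSub_X (M : Matrix (Fin n) (Fin n) ℂ) (k : Fin n) :
    linSub M (X k) = ∑ l, C (M k l) * X l := by
  simp [linSub]

theorem linSub_C (M : Matrix (Fin n) (Fin n) ℂ) (c : ℂ) : linSub M (C c) = C c := by
  rw [linSub, algHom_C]; rfl

theorem linSub_linSub (M N : Matrix (Fin n) (Fin n) ℂ) (p : MvPolynomial (Fin n) ℂ) :
    linSub M (linSub N p) = linSub (N * M) p := by
  have h : (linSub M).comp (linSub N) = linSub (N * M) := by
    refine MvPolynomial.algHom_ext fun k => ?_
    rw [AlgHom.comp_apply, linSub_X, linSub_X, map_sum]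
    simp only [map_mul, linSub_C, linSub_X, Finset.mul_sum, Matrix.mul_apply, map_sum,
      Finset.sum_mul]
    rw [Finset.sum_comm]
    exact Finset.sum_congr rfl fun i _ => Finset.sum_congr rfl fun j _ => by ring
  exact DFunLike.congr_fun h p

theorem linSub_one (p : MvPolynomial (Fin n) ℂ) : linSub 1 p = p := by
  have : (linSub 1 : MvPolynomial (Fin n) ℂ →ₐ[ℂ] _) = AlgHom.id ℂ _ := by
    refine MvPolynomial.algHom_ext fun k => ?_
    rw [linSub_X, AlgHom.id_apply, Finset.sum_eq_single k (fun l _ hl => by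
      simp [Matrix.one_apply_ne hl.symm]) (by simp)]
    simp
  rw [this, AlgHom.id_apply]

theorem eval_linSub (M : Matrix (Fin n) (Fin n) ℂ) (x : Fin n → ℂ) (p : MvPolynomial (Fin n) ℂ) :
    eval x (linSub M p) = eval (M.mulVec x) p := by
  induction p using MvPolynomial.induction_on with
  | C a => rw [linSub_C, eval_C, eval_C]
  | add p q hp hq => simp [hp, hq]
  | mul_X p i hp => simp [hp, linSub_X, Matrix.mulVec, dotProduct]

theorem squarefree_linSub {M : Matrix (Fin n) (Fin n) ℂ} (hM : IsUnit M.det)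
    {p : MvPolynomial (Fin n) ℂ} (hp : Squarefree p) : Squarefree (linSub M p) := by
  intro q hq
  have h1 := map_dvd (linSub M⁻¹) hq
  rw [map_mul, linSub_linSub, Matrix.mul_nonsing_inv _ hM, linSub_one] at h1
  have h2 := (hp _ h1).map (linSub M)
  rwa [linSub_linSub, Matrix.nonsing_inv_mul _ hM, linSub_one] at h2

theorem conjugate_apply (T : Matrix (Fin n) (Fin n) ℂ) (f : VField n) (i : Fin n) :
    conjugate T f i = ∑ j, C (T i j) * linSub T⁻¹ (f j) := rfl

theorem homogeneousComponent_conjugate (T : Matrix (Fin n) (Fin n) ℂ) (f : VField n) (i : Fin n)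
    (k : ℕ) : homogeneousComponent k (conjugate T f i) = conjugate T (homPart k f) i := by
  simp only [conjugate_apply, map_sum, homogeneousComponent_C_mul, linSub, homPart,
    homogeneousComponent_aeval (isHomogeneous_linForm _)]

theorem lieDeriv_conjugate {T : Matrix (Fin n) (Fin n) ℂ} (hT : IsUnit T.det) (f : VField n)
    (p : MvPolynomial (Fin n) ℂ) :
    lieDeriv (conjugate T f) (linSub T⁻¹ p) = linSub T⁻¹ (lieDeriv f p) := by
  have hST := Matrix.nonsing_inv_mul T hT
  have hconj := conjugate_apply T f
  generalize T⁻¹ = S at hST hconj ⊢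
  rw [← mkDerivation_eq_lieDeriv, ← mkDerivation_eq_lieDeriv]
  refine derivation_comp_of_X _ _ _ (fun k => ?_) p
  rw [linSub_X, mkDerivation_X, map_sum]
  have hD : ∀ l, mkDerivation ℂ (conjugate T f) (C (S k l) * X l) =
      ∑ j, C (S k l) * (C (T l j) * linSub S (f j)) := fun l => by
    rw [C_mul', Derivation.map_smul, mkDerivation_X, hconj, Finset.smul_sum]
    exact Finset.sum_congr rfl fun j _ => smul_eq_C_mul _ _
  rw [Finset.sum_congr rfl fun l _ => hD l, Finset.sum_comm]
  have : ∀ j, ∑ l, C (S k l) * (C (T l j) * linSub S (f j)) =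
      C ((S * T) k j) * linSub S (f j) := fun j => by
    simp only [Matrix.mul_apply, map_sum, Finset.sum_mul, C_mul, mul_assoc]
  rw [Finset.sum_congr rfl fun j _ => this j, hST,
    Finset.sum_eq_single k (fun l _ hl => by simp [Matrix.one_apply_ne hl.symm]) (by simp)]
  simp

theorem dvd_lieDeriv_conjugate {T : Matrix (Fin n) (Fin n) ℂ} (hT : IsUnit T.det) {f : VField n}
    {p : MvPolynomial (Fin n) ℂ} (h : p ∣ lieDeriv f p) :
    linSub T⁻¹ p ∣ lieDeriv (conjugate T f) (linSub T⁻¹ p) := by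
  rw [lieDeriv_conjugate hT]
  exact map_dvd _ h

theorem homogeneousComponent_one_eq (p : MvPolynomial (Fin n) ℂ) :
    homogeneousComponent 1 p = ∑ l, C (eval 0 (pderiv l p)) * X l := by
  have h := homogeneousComponent_isHomogeneous 1 p
  have h1 := h.sum_X_mul_pderiv
  rw [one_smul] at h1
  rw [← h1]
  refine Finset.sum_congr rfl fun l _ => ?_
  have h2 := homogeneousComponent_eq_self (h.pderiv (i := l))
  rw [homogeneousComponent_zero] at h2
  rw [← h2, mul_comm, eval_zero, constantCoeff_eq, coeff_pderiv, coeff_pderiv,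
    coeff_homogeneousComponent, if_pos (by simp)]

/-- A diagonalizing matrix of the Jacobian brings the linear part to diagonal form. -/
theorem hasDiagonalPart_conjugate {F : VField n} {lam : Fin n → ℂ} (hF0 : ∀ i, eval 0 (F i) = 0)
    {B : Matrix (Fin n) (Fin n) ℂ}
    (hdiag : B * jacobianAt F 0 * B⁻¹ = Matrix.diagonal lam) :
    HasDiagonalPart (conjugate B F) lam := by
  intro i
  have h0 : homogeneousComponent 0 (conjugate B F i) = 0 := by
    rw [homogeneousComponent_conjugate, conjugate_apply]
    refine Finset.sum_eq_zero fun j _ => ?_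
    rw [homPart, homogeneousComponent_zero, ← constantCoeff_eq, ← eval_zero, hF0 j, C_0, map_zero,
      mul_zero]
  have h1 : homogeneousComponent 1 (conjugate B F i) = C (lam i) * X i := by
    rw [homogeneousComponent_conjugate, conjugate_apply]
    have : ∀ j, C (B i j) * linSub B⁻¹ (homPart 1 F j) =
        ∑ k, ∑ l, C (B i j * jacobianAt F 0 j l * B⁻¹ l k) * X k := fun j => by
      rw [homPart, homogeneousComponent_one_eq, map_sum, Finset.mul_sum, Finset.sum_comm]
      refine Finset.sum_congr rfl fun l _ => ?_
      rw [map_mul, linSub_C, linSub_X, Finset.mul_sum, Finset.mul_sum]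
      refine Finset.sum_congr rfl fun k _ => ?_
      rw [C_mul, C_mul, jacobianAt, Matrix.of_apply]
      ring
    rw [Finset.sum_congr rfl fun j _ => this j, Finset.sum_comm]
    have h2 : ∀ k, ∑ j, ∑ l, C (B i j * jacobianAt F 0 j l * B⁻¹ l k) * X k =
        C (Matrix.diagonal lam i k) * X k := fun k => by
      rw [← hdiag, Matrix.mul_assoc]
      simp only [Matrix.mul_apply, map_sum, Finset.sum_mul, Finset.mul_sum, mul_assoc]
    rw [Finset.sum_congr rfl fun k _ => h2 k,
      Finset.sum_eq_single i (fun l _ hl => by simp [Matrix.diagonal_apply_ne _ hl.symm])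
        (by simp), Matrix.diagonal_apply_eq]
  refine mem_pow_succ_of_homogeneousComponent_eq_zero
    (mem_pow_succ_of_homogeneousComponent_eq_zero (k := 0) (mem_pow_zero _) ?_) ?_
  · rw [map_sub, h0, homogeneousComponent_of_mem (isHomogeneous_C_mul_X _ _)]
    simp
  · rw [map_sub, h1, homogeneousComponent_eq_self (isHomogeneous_C_mul_X _ _), sub_self]

/-! ### Diagonalization and integer relations between the eigenvalues -/

theorem exists_diagonalizing {A : Matrix (Fin n) (Fin n) ℂ} {μ : Fin n → ℂ}
    (hA : A.charpoly = ∏ i, (Polynomial.X - Polynomial.C (μ i))) (hμ : Function.Injective μ) :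
    ∃ B : Matrix (Fin n) (Fin n) ℂ, IsUnit B.det ∧ B * A * B⁻¹ = Matrix.diagonal μ := by
  have hv : ∀ i, ∃ v, v ≠ 0 ∧ A.mulVec v = μ i • v := fun i => by
    have h1 : (Matrix.scalar (Fin n) (μ i) - A).det = 0 := by
      rw [← Matrix.eval_charpoly, hA, Polynomial.eval_prod]
      exact Finset.prod_eq_zero (Finset.mem_univ i) (by simp)
    obtain ⟨v, hv0, hv⟩ := Matrix.exists_mulVec_eq_zero_iff.mpr h1
    refine ⟨v, hv0, ?_⟩
    rw [Matrix.sub_mulVec, sub_eq_zero] at hv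
    rw [← hv, Matrix.scalar_apply, ← Matrix.smul_one_eq_diagonal, Matrix.smul_mulVec,
      Matrix.one_mulVec]
  choose v hv0 hv using hv
  have hli : LinearIndependent ℂ v := by
    refine Module.End.eigenvectors_linearIndependent' (Matrix.toLin' A) μ hμ v fun i => ?_
    rw [Module.End.hasEigenvector_iff, Module.End.mem_eigenspace_iff, Matrix.toLin'_apply]
    exact ⟨hv i, hv0 i⟩
  set V : Matrix (Fin n) (Fin n) ℂ := Matrix.of fun i j => v j i with hV
  have hVu : IsUnit V := Matrix.linearIndependent_cols_iff_isUnit.mp hli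
  have hVdet : IsUnit V.det := (Matrix.isUnit_iff_isUnit_det _).mp hVu
  have hAV : A * V = V * Matrix.diagonal μ := by
    ext i j
    have := congrFun (hv j) i
    rw [Matrix.mul_diagonal, Matrix.mul_apply]
    simpa [Matrix.mulVec, dotProduct, hV, mul_comm] using this
  refine ⟨V⁻¹, Matrix.isUnit_nonsing_inv_det _ hVdet, ?_⟩
  rw [Matrix.nonsing_inv_nonsing_inv _ hVdet, Matrix.mul_assoc, hAV, ← Matrix.mul_assoc,
    Matrix.nonsing_inv_mul _ hVdet, Matrix.one_mul]

/-- Under the second condition, rank-nullity makes the space of rational relations one-dimensional,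
spanned by the given positive relation. -/
theorem signedRelations_of_eigCond {μ : Fin n → ℂ} (h : EigCondOne μ ∨ EigCondTwo μ) :
    SignedRelations μ := by
  intro z hz
  have hz' : ∑ i, (z i : ℚ) • μ i = 0 := by
    rw [← hz]
    exact Finset.sum_congr rfl fun i _ => by rw [Rat.smul_def]; push_cast; rfl
  rcases h with h | ⟨hrank, d, hd, hdμ⟩
  · left
    ext i
    exact_mod_cast Fintype.linearIndependent_iff.mp h _ hz' i
  · have hrn := (Fintype.linearCombination ℚ μ).finrank_range_add_finrank_ker
    rw [Fintype.range_linearCombination, Module.finrank_fin_fun] at hrn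
    have hker : Module.finrank ℚ (LinearMap.ker (Fintype.linearCombination ℚ μ)) = 1 := by lia
    have hn : 0 < n := by lia
    have hdk : (fun i => (d i : ℚ)) ∈ LinearMap.ker (Fintype.linearCombination ℚ μ) := by
      rw [LinearMap.mem_ker, Fintype.linearCombination_apply, ← hdμ]
      exact Finset.sum_congr rfl fun i _ => by rw [Rat.smul_def]; push_cast; rfl
    have hzk : (fun i => (z i : ℚ)) ∈ LinearMap.ker (Fintype.linearCombination ℚ μ) := by
      rw [LinearMap.mem_ker, Fintype.linearCombination_apply, hz']
    have hne : (⟨_, hdk⟩ : LinearMap.ker (Fintype.linearCombination ℚ μ)) ≠ 0 := by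
      intro h0
      have := congrFun (congrArg Subtype.val h0) ⟨0, hn⟩
      have h1 := hd ⟨0, hn⟩
      simp at this
      lia
    obtain ⟨c, hc⟩ := (finrank_eq_one_iff_of_nonzero' _ hne).mp hker ⟨_, hzk⟩
    have hc' : ∀ i, c * d i = z i := fun i => congrFun (congrArg Subtype.val hc) i
    have hd' : ∀ i, (0 : ℚ) < d i := fun i => by exact_mod_cast hd i
    rcases lt_trichotomy c 0 with h | h | h
    · refine Or.inr (Or.inr fun i => ?_)
      have : (z i : ℚ) < 0 := by rw [← hc' i]; exact mul_neg_of_neg_of_pos h (hd' i)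
      exact_mod_cast this
    · refine Or.inl (funext fun i => ?_)
      have : (z i : ℚ) = 0 := by rw [← hc' i, h, zero_mul]
      exact_mod_cast this
    · refine Or.inr (Or.inl fun i => ?_)
      have : (0 : ℚ) < z i := by rw [← hc' i]; exact mul_pos h (hd' i)
      exact_mod_cast this

/-- An equality μᵢ = μⱼ would be a relation with coefficients 1 and -1. Distinctness is what makes
the Jacobian diagonalizable. -/
theorem SignedRelations.injective {μ : Fin n → ℂ} (h : SignedRelations μ) :
    Function.Injective μ := by
  intro i j hij
  by_contra hne
  have hsum : ∑ k, ((Pi.single i 1 - Pi.single j 1 : Fin n → ℤ) k : ℂ) * μ k = 0 := by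
    have h1 : ∀ l : Fin n, ∑ k, ((Pi.single l 1 : Fin n → ℤ) k : ℂ) * μ k = μ l := fun l => by
      rw [Finset.sum_eq_single l (fun k _ hk => by simp [hk]) (by simp)]
      simp
    simp only [Pi.sub_apply, Int.cast_sub, sub_mul, Finset.sum_sub_distrib, h1, hij, sub_self]
  rcases h _ hsum with h0 | h0 | h0
  · have := congrFun h0 i
    simp [hne] at this
  · have := h0 j
    simp [Ne.symm hne] at this
  · have := h0 i
    simp [hne] at this

/-- If the Jacobian at the stationary point `0` satisfies the eigenvalue condition, then the
product of a homogeneous linear semi-invariant `z` and a semi-invariant `P` is not squarefree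
whenever `P` has a multiple factor through `0` modulo `z`. -/
theorem not_squarefree_of_eigCond {F : VField n} (hF0 : ∀ i, eval 0 (F i) = 0)
    (hE : EigCond (jacobianAt F 0)) {z P q S W : MvPolynomial (Fin n) ℂ}
    (hz : z ∣ lieDeriv F z) (hz1 : z.IsHomogeneous 1) (hP : P ∣ lieDeriv F P)
    (hPq : P = q * q * S + z * W) (hq : eval 0 q = 0) : ¬ Squarefree (z * P) := by
  obtain ⟨μ, hchar, hμ⟩ := hE
  have hrel := signedRelations_of_eigCond hμ
  obtain ⟨B, hB, hdiag⟩ := exists_diagonalizing hchar hrel.injective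
  intro hsq
  have hB' := Matrix.isUnit_nonsing_inv_det _ hB
  refine not_squarefree_of_diagonal (hasDiagonalPart_conjugate hF0 hdiag) hrel
    (z := linSub B⁻¹ z) (P := linSub B⁻¹ P) (q := linSub B⁻¹ q) (S := linSub B⁻¹ S)
    (W := linSub B⁻¹ W) (dvd_lieDeriv_conjugate hB hz) ?_ (dvd_lieDeriv_conjugate hB hP) ?_ ?_ ?_
  · have := hz1.aeval _ (isHomogeneous_linForm B⁻¹)
    rwa [mul_one] at this
  · rw [hPq]; simp only [map_add, map_mul]
  · rw [eval_linSub, Matrix.mulVec_zero, hq]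
  · rw [← map_mul]; exact squarefree_linSub hB' hsq

end Linear
end PolyVF

namespace PolyVF

/-! ### Zero sets of semi-invariants and invariant lines -/

section Flow

variable {n : ℕ}

theorem hasDerivAt_eval_solution {p : VField n} {γ : ℝ → Fin n → ℂ} {t : ℝ}
    (hγ : HasDerivAt γ (fun i => eval (γ t) (p i)) t) (q : MvPolynomial (Fin n) ℂ) :
    HasDerivAt (fun s => eval (γ s) q) (eval (γ t) (lieDeriv p q)) t := by
  induction q using MvPolynomial.induction_on with
  | C a => simpa [lieDeriv_C] using hasDerivAt_const t a
  | add q r hq hr => simpa [lieDeriv_add] using hq.fun_add hr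
  | mul_X q i hq =>
    have h := hq.fun_mul (hasDerivAt_pi.mp hγ i)
    rw [lieDeriv_mul, lieDeriv_X]
    simp only [map_mul, map_add, eval_X]
    rw [add_comm, mul_comm (γ t i)]
    exact h

theorem contDiff_eval (p : VField n) :
    ContDiff ℝ 1 (fun x : Fin n → ℂ => fun i => eval x (p i)) := by
  refine contDiff_pi.mpr fun i => ?_
  induction p i using MvPolynomial.induction_on with
  | C a => simpa using contDiff_const
  | add q r hq hr => simpa using hq.add hr
  | mul_X q k hq => simpa using hq.mul (contDiff_apply ℝ ℂ k)

/-- The zero set of a semi-invariant is an invariant set. -/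
theorem isInvariantSet_zeroSet {p : VField n} {q : MvPolynomial (Fin n) ℂ}
    (hq : q ∣ lieDeriv p q) : IsInvariantSet p {x | eval x q = 0} := by
  obtain ⟨L, hL⟩ := hq
  intro a b γ ha hb hγ h0 t ht
  -- On a compact interval around 0 and t the cofactor is bounded along γ. There q(γ) solves the
  -- linear equation u' = L(γ)u with u(0) = 0, so it vanishes by uniqueness.
  obtain ⟨a', ha'1, ha'2⟩ := exists_between (lt_min ha ht.1)
  obtain ⟨b', hb'1, hb'2⟩ := exists_between (max_lt hb ht.2)
  rw [lt_min_iff] at ha'2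
  rw [max_lt_iff] at hb'1
  have hsub : Set.Icc a' b' ⊆ Set.Ioo a b := fun s hs =>
    ⟨ha'1.trans_le hs.1, hs.2.trans_lt hb'2⟩
  have hcont : ContinuousOn γ (Set.Icc a' b') := fun s hs =>
    (hγ s (hsub hs)).continuousAt.continuousWithinAt
  have hLc : ContinuousOn (fun s => eval (γ s) L) (Set.Icc a' b') :=
    (MvPolynomial.continuous_eval L).comp_continuousOn hcont
  have hqc : ContinuousOn (fun s => eval (γ s) q) (Set.Icc a' b') :=
    (MvPolynomial.continuous_eval q).comp_continuousOn hcont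
  obtain ⟨K, hK⟩ := isCompact_Icc.exists_bound_of_continuousOn hLc
  have hEq := ODE_solution_unique_of_mem_Icc (K := K.toNNReal) (s := fun _ => Set.univ)
    (v := fun s u => eval (γ s) L * u) (t₀ := 0) (a := a') (b := b')
    (f := fun s => eval (γ s) q) (g := fun _ => 0)
    (fun s hs => by
      refine LipschitzOnWith.of_dist_le_mul fun x _ y _ => ?_
      rw [dist_eq_norm, dist_eq_norm, ← mul_sub, norm_mul]
      refine mul_le_mul_of_nonneg_right ?_ (norm_nonneg _)
      exact (hK s (Set.Ioo_subset_Icc_self hs)).trans (Real.le_coe_toNNReal K))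
    ⟨ha'2.1, hb'1.1⟩ hqc
    (fun s hs => by
      have := hasDerivAt_eval_solution (hγ s (hsub (Set.Ioo_subset_Icc_self hs))) q
      rwa [hL, map_mul, mul_comm] at this)
    (fun _ _ => Set.mem_univ _) continuousOn_const
    (fun s hs => by simpa using hasDerivAt_const s (0 : ℂ))
    (fun _ _ => Set.mem_univ _) h0
  exact hEq ⟨ha'2.2.le, hb'1.2.le⟩

/-- A vector field is tangent to its invariant lines. -/
theorem exists_eval_eq_smul_of_isInvariantSet {p : VField n} {v : Fin n → ℂ} (hv : v ≠ 0)
    (h : IsInvariantSet p (Submodule.span ℂ {v} : Set (Fin n → ℂ))) :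
    ∃ α : ℂ, ∀ i, eval v (p i) = α * v i := by
  obtain ⟨k, hk⟩ := Function.ne_iff.mp hv
  rw [Pi.zero_apply] at hk
  obtain ⟨γ, hγ0, ε, hε, hγ⟩ :=
    (contDiff_eval p).contDiffAt.exists_forall_mem_closedBall_exists_eq_forall_mem_Ioo_hasDerivAt₀
      (x₀ := v) 0
  rw [zero_sub, zero_add] at hγ
  have hmem := h (-ε) ε γ (by linarith) hε hγ
    (by rw [hγ0]; exact Submodule.mem_span_singleton_self v)
  refine ⟨eval v (p k) / v k, fun i => ?_⟩
  have h0 := hγ 0 ⟨by linarith, hε⟩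
  rw [hasDerivAt_pi] at h0
  have h1 := ((h0 i).mul_const (v k)).sub ((h0 k).mul_const (v i))
  -- The solution stays on the line, so its 2×2 minors with v vanish; their derivative at 0 gives
  -- the proportionality.
  have h2 : (fun s => γ s i * v k - γ s k * v i) =ᶠ[nhds 0] fun _ => 0 := by
    filter_upwards [Ioo_mem_nhds (show -ε < 0 by linarith) hε] with s hs
    obtain ⟨c, hc⟩ := Submodule.mem_span_singleton.mp (hmem s hs)
    simp only [← hc, Pi.smul_apply, smul_eq_mul]
    ring
  have h3 := h1.unique ((hasDerivAt_const (0 : ℝ) (0 : ℂ)).congr_of_eventuallyEq h2)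
  rw [hγ0] at h3
  field_simp
  linear_combination h3

/-- By the Nullstellensatz the coordinate ring is the quotient by the prime ideal (q). In dimension
0 this ideal would be the maximal ideal of the origin, and q would be associated to two different
variables. -/
theorem one_le_varietyDim_zeroSet (hn : 2 ≤ n) {q : MvPolynomial (Fin n) ℂ} (hq : Irreducible q)
    (h0 : eval 0 q = 0) : 1 ≤ varietyDim {x | eval x q = 0} := by
  have hprime : (Ideal.span {q}).IsPrime := (Ideal.span_singleton_prime hq.ne_zero).mpr hq.prime
  have hset : {x : Fin n → ℂ | eval x q = 0} = zeroLocus ℂ (Ideal.span {q}) := by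
    ext x
    rw [zeroLocus_span]
    simp
  rw [varietyDim, hset, IsPrime.vanishingIdeal_zeroLocus]
  have hpos := ENat.WithBot.add_one_le_iff (n := 0)
    (m := ringKrullDim (MvPolynomial (Fin n) ℂ ⧸ Ideal.span {q}))
  simp only [Nat.cast_zero, zero_add] at hpos
  rw [hpos]
  refine lt_of_le_of_ne ringKrullDim_nonneg_of_nontrivial fun h => ?_
  have : Ring.KrullDimLE 0 (MvPolynomial (Fin n) ℂ ⧸ Ideal.span {q}) :=
    ringKrullDimZero_iff_ringKrullDim_eq_zero.mpr h.symm
  have hmax := Ideal.Quotient.maximal_of_isField _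
    (Ring.KrullDimLE.isField_of_isDomain (R := MvPolynomial (Fin n) ℂ ⧸ Ideal.span {q}))
  have hle : Ideal.span {q} ≤ vanishingIdeal ℂ {(0 : Fin n → ℂ)} := by
    rw [Ideal.span_singleton_le_iff_mem, mem_vanishingIdeal_singleton_iff]
    simpa [coe_aeval_eq_eval] using h0
  have heq := hmax.eq_of_le (by
    rw [Ne, Ideal.eq_top_iff_one, mem_vanishingIdeal_singleton_iff]; simp) hle
  have hX : ∀ i : Fin n, q ∣ X i := fun i => by
    rw [← Ideal.mem_span_singleton, heq, mem_vanishingIdeal_singleton_iff]; simp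
  have hdvd : ∀ i : Fin n, X i ∣ q := fun i =>
    (hq.dvd_symm (X_prime (i := i)).irreducible (hX i))
  have := (hdvd ⟨0, by lia⟩).trans (hX ⟨1, by lia⟩)
  rw [X_dvd_X] at this
  simp at this

/-- Property S supplies a point on a semi-invariant cone at which `f^(m)` is radial. -/
theorem exists_radial_point (hn : 2 ≤ n) {f : VField n} {m : ℕ} (hS : PropertyS f m)
    {q : MvPolynomial (Fin n) ℂ} (hq : Irreducible q) {d : ℕ} (hd : q.IsHomogeneous d)
    (hdvd : q ∣ lieDeriv (homPart m f) q) :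
    ∃ v : Fin n → ℂ, v ≠ 0 ∧ eval v q = 0 ∧ ∃ α : ℂ, ∀ i, eval v (homPart m f i) = α * v i := by
  have hd0 : d ≠ 0 := by
    rintro rfl
    have h1 := homogeneousComponent_eq_self hd
    rw [homogeneousComponent_zero] at h1
    have hc : coeff 0 q ≠ 0 := fun h => hq.ne_zero (by rw [← h1, h, C_0])
    exact hq.not_isUnit (by rw [← h1]; exact hc.isUnit.map C)
  have h0 : eval 0 q = 0 := by
    rw [eval_zero, constantCoeff_eq]
    exact hd.coeff_eq_zero (by simpa using hd0.symm)
  obtain ⟨v, hv, hvY, hinv⟩ := hS {x | eval x q = 0}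
    ⟨{q}, by rintro _ rfl; exact ⟨d, hd⟩, by simp⟩
    (fun h => hq.ne_zero (MvPolynomial.funext fun x => by
      rw [map_zero]; exact (Set.eq_univ_iff_forall.mp h x)))
    (isInvariantSet_zeroSet hdvd) (one_le_varietyDim_zeroSet hn hq h0)
  exact ⟨v, hv, hvY (Submodule.mem_span_singleton_self v),
    exists_eval_eq_smul_of_isInvariantSet hv hinv⟩

end Flow
end PolyVF

namespace PolyVF

/-! ### Highest degree parts of semi-invariants -/

section TopPart

variable {n : ℕ}

theorem topPart_ne_zero {p : MvPolynomial (Fin n) ℂ} (hp : p ≠ 0) : topPart p ≠ 0 :=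
  homogeneousComponent_totalDegree_ne_zero hp

theorem topPart_isHomogeneous (p : MvPolynomial (Fin n) ℂ) :
    (topPart p).IsHomogeneous p.totalDegree :=
  homogeneousComponent_isHomogeneous _ _

theorem homogeneousComponent_pderiv (k : ℕ) (i : Fin n) (p : MvPolynomial (Fin n) ℂ) :
    homogeneousComponent k (pderiv i p) = pderiv i (homogeneousComponent (k + 1) p) := by
  ext d
  rw [coeff_homogeneousComponent, coeff_pderiv, coeff_pderiv, coeff_homogeneousComponent, map_add,
    Finsupp.degree_single]
  simp only [Nat.add_right_cancel_iff]
  split_ifs <;> simp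

/-- Compare the components of degree m + r - 1, r = deg p, in X_f(p) = Lp: on the left only f^(m)
and the highest degree part of p contribute. -/
theorem dvd_lieDeriv_topPart {f : VField n} {m : ℕ} (hf : ∀ i, (f i).totalDegree ≤ m)
    {p : MvPolynomial (Fin n) ℂ} (hp0 : p ≠ 0) (hp1 : 1 ≤ p.totalDegree) (hp : p ∣ lieDeriv f p) :
    topPart p ∣ lieDeriv (homPart m f) (topPart p) := by
  obtain ⟨L, hL⟩ := hp
  have h1 : homogeneousComponent (m + (p.totalDegree - 1)) (lieDeriv f p) =
      lieDeriv (homPart m f) (topPart p) := by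
    rw [lieDeriv, map_sum, lieDeriv]
    refine Finset.sum_congr rfl fun i _ => ?_
    rw [homogeneousComponent_add_mul (hf i) (totalDegree_pderiv_le p i),
      homogeneousComponent_pderiv, Nat.sub_add_cancel hp1]
    rfl
  rw [← h1, hL]
  by_cases hL0 : L = 0
  · simp [hL0]
  · have h2 := totalDegree_lieDeriv_le hf p
    rw [hL, totalDegree_mul_of_isDomain hp0 hL0] at h2
    obtain ⟨b, hb⟩ := Nat.exists_eq_add_of_le (le_of_add_le_left h2)
    rw [hb, homogeneousComponent_add_mul le_rfl (by lia)]
    exact dvd_mul_right _ _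

theorem IsSemiInvariant.one_le_totalDegree {f : VField n} {p : MvPolynomial (Fin n) ℂ}
    (hp : IsSemiInvariant f p) : 1 ≤ p.totalDegree := by
  by_contra h
  exact hp.1 _ (totalDegree_eq_zero_iff_eq_C.mp (by lia))

theorem IsSemiInvariant.dvd {f : VField n} {p : MvPolynomial (Fin n) ℂ}
    (hp : IsSemiInvariant f p) : p ∣ lieDeriv f p := by
  obtain ⟨L, hL⟩ := hp.2
  exact Dvd.intro_left L hL.symm

theorem isSemiInvariant_of_irreducible {f : VField n} {p : MvPolynomial (Fin n) ℂ}
    (hp : Irreducible p) (h : p ∣ lieDeriv f p) : IsSemiInvariant f p := by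
  refine ⟨?_, ?_⟩
  · rintro c rfl
    by_cases hc : c = 0
    · exact hp.ne_zero (by rw [hc, C_0])
    · exact hp.not_isUnit ((Ne.isUnit hc).map C)
  · obtain ⟨L, hL⟩ := h
    exact ⟨L, by rw [hL, mul_comm]⟩

/-- Irreducible factors of the highest degree part of a semi-invariant of `f` are semi-invariants
of `f^(m)`. -/
theorem dvd_lieDeriv_of_dvd_topPart {f : VField n} {m : ℕ} (hf : ∀ i, (f i).totalDegree ≤ m)
    {p q : MvPolynomial (Fin n) ℂ} (hp0 : p ≠ 0) (hp : IsSemiInvariant f p) (hq : Irreducible q)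
    (hqp : q ∣ topPart p) : q ∣ lieDeriv (homPart m f) q :=
  dvd_lieDeriv_of_irreducible_dvd (topPart_ne_zero hp0)
    (dvd_lieDeriv_topPart hf hp0 hp.one_le_totalDegree hp.dvd) hq hqp

theorem totalDegree_linSub {M : Matrix (Fin n) (Fin n) ℂ} (hM : IsUnit M.det)
    (p : MvPolynomial (Fin n) ℂ) : (linSub M p).totalDegree = p.totalDegree := by
  refine le_antisymm (totalDegree_aeval_le (isHomogeneous_linForm M) p) ?_
  have h := totalDegree_aeval_le (isHomogeneous_linForm M⁻¹) (linSub M p)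
  change (linSub M⁻¹ (linSub M p)).totalDegree ≤ _ at h
  rwa [linSub_linSub, Matrix.mul_nonsing_inv _ hM, linSub_one] at h

theorem topPart_linSub {M : Matrix (Fin n) (Fin n) ℂ} (hM : IsUnit M.det)
    (p : MvPolynomial (Fin n) ℂ) : topPart (linSub M p) = linSub M (topPart p) := by
  rw [topPart, totalDegree_linSub hM]
  exact homogeneousComponent_aeval (isHomogeneous_linForm M) _ p

theorem X_dvd_sub_rename_substAt (k : Fin (n + 1)) (P : MvPolynomial (Fin (n + 1)) ℂ) :
    X k ∣ P - rename k.succAbove (substAt k 0 P) := by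
  induction P using MvPolynomial.induction_on with
  | C a => simp [substAt]
  | add p q hp hq =>
    rw [map_add, map_add, add_sub_add_comm]
    exact dvd_add hp hq
  | mul_X p i hp =>
    have hX : X k ∣ (X i : MvPolynomial (Fin (n + 1)) ℂ) -
        rename k.succAbove (substAt k 0 (X i)) := by
      refine Fin.succAboveCases k ?_ (fun j => ?_) i
      · simp [substAt_X_self]
      · simp [substAt_X_succAbove]
    rw [map_mul, map_mul]
    have : p * X i - rename k.succAbove (substAt k 0 p) * rename k.succAbove (substAt k 0 (X i)) =
        (p - rename k.succAbove (substAt k 0 p)) * X i +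
        rename k.succAbove (substAt k 0 p) * (X i - rename k.succAbove (substAt k 0 (X i))) := by
      ring
    rw [this]
    exact dvd_add (Dvd.dvd.mul_right hp _) (Dvd.dvd.mul_left hX _)

theorem substAt_zero_homAt (k : Fin (n + 1)) (N : ℕ) (p : MvPolynomial (Fin n) ℂ) :
    substAt k 0 (homAt k N p) = homogeneousComponent N p := by
  have h := map_dvd (substAt k 0) (X_dvd_homAt_sub k N p)
  rwa [substAt_X_self, zero_dvd_iff, map_sub, substAt_rename, sub_eq_zero] at h

end TopPart

/-! ### Stationary points of Poincaré transforms -/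

section Stationary

variable {n : ℕ}

theorem totalDegree_conjugate_le {f : VField n} {m : ℕ} (hf : ∀ i, (f i).totalDegree ≤ m)
    (T : Matrix (Fin n) (Fin n) ℂ) (i : Fin n) : (conjugate T f i).totalDegree ≤ m := by
  rw [conjugate_apply]
  refine totalDegree_finsetSum_le fun j _ => ?_
  refine (totalDegree_mul _ _).trans ?_
  rw [totalDegree_C, zero_add]
  exact (totalDegree_aeval_le (isHomogeneous_linForm _) _).trans (hf j)

theorem eval_zero_setFirstOne_rename (hn : 0 < n) (p : MvPolynomial (Fin n) ℂ) :
    eval 0 (setFirstOne (rename (Fin.last n).succAbove p)) = eval (e1 n) p := by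
  rw [setFirstOne_eq_substAt, eval_substAt, eval_rename]
  congr 2
  ext i
  obtain ⟨n, rfl⟩ := Nat.exists_eq_succ_of_ne_zero hn.ne'
  rw [Fin.insertNth_zero', Function.comp_apply, Fin.succAbove_last_apply]
  refine Fin.cases ?_ (fun j => ?_) i
  · simp [e1]
  · rw [← Fin.succ_castSucc, Fin.cons_succ]
    simp [e1]

/-- At 0 the terms with a factor xⱼ vanish, leaving the components 2, …, n of h^(m)(e₁) = T f^(m)(v)
= αe₁ and the last component 0. -/
theorem eval_poincare_eq_zero (hn : 0 < n) {f : VField n} (m : ℕ) {v : Fin n → ℂ}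
    {T : Matrix (Fin n) (Fin n) ℂ} (hT : IsUnit T.det) (hTv : T.mulVec v = e1 n) {α : ℂ}
    (hα : ∀ i, eval v (homPart m f i) = α * v i) (j : Fin n) : eval 0 (poincare m T f j) = 0 := by
  have hv : T⁻¹.mulVec (e1 n) = v := by
    rw [← hTv, Matrix.mulVec_mulVec, Matrix.nonsing_inv_mul _ hT, Matrix.one_mulVec]
  rw [poincare, poincareE1, map_add, map_mul, eval_X, Pi.zero_apply, mul_zero, zero_add]
  have key : ∀ i : Fin n, i.castSucc = j.succ →
      eval 0 (setFirstOne (homogenizePoly m (conjugate T f i))) = 0 := fun i hi => by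
    have h1 := map_dvd (substAt 0 1) (X_dvd_homAt_sub (Fin.last n) m (conjugate T f i))
    have h2 := map_dvd (eval (0 : Fin n → ℂ)) h1
    obtain ⟨k, hk⟩ := Fin.exists_succ_eq.mpr (show Fin.last n ≠ 0 by
      rw [Ne, Fin.ext_iff]; simpa using hn.ne')
    rw [← hk] at h2
    rw [← Fin.succAbove_zero_apply, substAt_X_succAbove, eval_X, Pi.zero_apply, zero_dvd_iff,
      map_sub, map_sub, sub_eq_zero, Fin.succAbove_zero_apply, hk, ← setFirstOne_eq_substAt,
      ← setFirstOne_eq_substAt, eval_zero_setFirstOne_rename hn, homogeneousComponent_conjugate,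
      conjugate_apply T (homPart m f)] at h2
    rw [homogenizePoly_eq_homAt, h2]
    simp only [map_sum, map_mul, eval_C, eval_linSub, hv, hα]
    have h3 := congrFun hTv i
    rw [Matrix.mulVec, dotProduct] at h3
    have h4 : ∑ x, T i x * (α * v x) = α * ∑ x, T i x * v x := by
      rw [Finset.mul_sum]
      exact Finset.sum_congr rfl fun x _ => by ring
    rw [h4, h3, e1, if_neg, mul_zero]
    have := congrArg Fin.val hi
    simp at this
    lia
  by_cases hj : j.succ = Fin.last n
  · rw [hj, homogenizeVF, Fin.snoc_last, setFirstOne_eq_substAt, map_zero, map_zero]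
  · obtain ⟨i, hi⟩ := Fin.exists_castSucc_eq.mpr hj
    rw [← hi, homogenizeVF, Fin.snoc_castSucc]
    exact key i hi

theorem exists_matrix_mulVec_eq_e1 (hn : 0 < n) {v : Fin n → ℂ} (hv : v ≠ 0) :
    ∃ T : Matrix (Fin n) (Fin n) ℂ, IsUnit T.det ∧ T.mulVec v = e1 n := by
  have he : e1 n ≠ 0 := fun h => by
    have := congrFun h ⟨0, hn⟩
    simp [e1] at this
  obtain ⟨A, hA⟩ := SeparatingDual.exists_continuousLinearEquiv_apply_eq (R := ℂ) hv he
  refine ⟨LinearMap.toMatrix' A.toLinearEquiv.toLinearMap, ?_, ?_⟩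
  · rw [LinearMap.det_toMatrix']
    exact A.toLinearEquiv.isUnit_det'
  · rw [LinearMap.toMatrix'_mulVec]
    exact hA

end Stationary

/-! ### Multiplicities of the factors of the highest degree parts -/

section Main

variable {n : ℕ}

/-- Property S turns ψ into a point at infinity where property E holds; a square factor ψ² would
give the product of the homogenized φᵢ a multiple factor along the hyperplane at infinity, against
`not_squarefree_of_eigCond`. -/
theorem not_sq_dvd_prod_topPart (hn : 2 ≤ n) {m : ℕ} {f : VField n} (hf : HasDegree f m)
    (hE : PropertyE f m) (hS : PropertyS f m) {s : ℕ} {φ : Fin s → MvPolynomial (Fin n) ℂ}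
    (hirr : ∀ i, Irreducible (φ i)) (hsemi : ∀ i, IsSemiInvariant f (φ i))
    (hprime : ∀ i i', i ≠ i' → IsRelPrime (φ i) (φ i')) {ψ : MvPolynomial (Fin n) ℂ}
    (hψ : Irreducible ψ) {i₀ : Fin s} (hi₀ : ψ ∣ topPart (φ i₀)) :
    ¬ ψ * ψ ∣ ∏ i, topPart (φ i) := by
  rintro ⟨S, hS'⟩
  have hn0 : 0 < n := by lia
  obtain ⟨d, hd⟩ := isHomogeneous_of_dvd (topPart_isHomogeneous _)
    (topPart_ne_zero (hirr i₀).ne_zero) hi₀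
  obtain ⟨v, hv, hvψ, α, hα⟩ := exists_radial_point hn hS hψ hd
    (dvd_lieDeriv_of_dvd_topPart hf.1 (hirr i₀).ne_zero (hsemi i₀) hψ hi₀)
  obtain ⟨T, hT, hTv⟩ := exists_matrix_mulVec_eq_e1 hn0 hv
  have hT' := Matrix.isUnit_nonsing_inv_det _ hT
  have hTe : T⁻¹.mulVec (e1 n) = v := by
    rw [← hTv, Matrix.mulVec_mulVec, Matrix.nonsing_inv_mul _ hT, Matrix.one_mulVec]
  have hstat := eval_poincare_eq_zero hn0 m hT hTv hα
  have hinj : Function.Injective (linSub T⁻¹ : MvPolynomial (Fin n) ℂ → _) :=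
    Function.LeftInverse.injective (g := linSub T) fun p => by
      rw [linSub_linSub, Matrix.nonsing_inv_mul _ hT, linSub_one]
  set χ : Fin s → MvPolynomial (Fin n) ℂ := fun i => linSub T⁻¹ (φ i)
  have hχ0 : ∀ i, χ i ≠ 0 := fun i => (map_ne_zero_iff _ hinj).mpr (hirr i).ne_zero
  set Φ : Fin s → MvPolynomial (Fin (n + 1)) ℂ :=
    fun i => homAt (Fin.last n) (χ i).totalDegree (χ i)
  set Z : MvPolynomial (Fin (n + 1)) ℂ := X (Fin.last n)
  have hPhom : (∏ i, Φ i).IsHomogeneous (∑ i, (χ i).totalDegree) :=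
    IsHomogeneous.prod _ _ _ fun i _ => homAt_isHomogeneous _ _ _
  have hPX : ¬ Z ∣ ∏ i, Φ i := fun h => by
    obtain ⟨i, -, hi⟩ := (Prime.dvd_finsetProd_iff X_prime _).mp h
    exact not_X_dvd_homAt _ (homogeneousComponent_totalDegree_ne_zero (hχ0 i)) hi
  have hPsq : Squarefree (∏ i, Φ i) := by
    refine squarefree_of_substAt_one _ hPhom hPX ?_
    have : substAt (Fin.last n) 1 (∏ i, Φ i) = linSub T⁻¹ (∏ i, φ i) := by
      rw [map_prod, map_prod]
      exact Finset.prod_congr rfl fun i _ => substAt_one_homAt _ le_rfl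
    rw [this]
    refine squarefree_linSub hT' (Finset.squarefree_prod_of_pairwise_isCoprime
      (fun i _ j _ hij => hprime i j hij) fun i _ => (hirr i).squarefree)
  have hsq : Squarefree (Z * ∏ i, Φ i) :=
    squarefree_mul_iff.mpr ⟨isRelPrime_X_of_not_dvd hPX, X_prime.irreducible.squarefree, hPsq⟩
  have hsq' : Squarefree (setFirstOne Z * setFirstOne (∏ i, Φ i)) := by
    have := squarefree_substAt_one 0 ((isHomogeneous_X ℂ (Fin.last n)).mul hPhom) hsq
    rwa [map_mul, ← setFirstOne_eq_substAt, ← setFirstOne_eq_substAt] at this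
  have hdeg := totalDegree_conjugate_le hf.1 T
  have hZd : Z ∣ lieDeriv (homogenizeVF m (conjugate T f)) Z := by
    rw [lieDeriv_X, homogenizeVF, Fin.snoc_last]
    exact dvd_zero _
  have hPd : ∏ i, Φ i ∣ lieDeriv (homogenizeVF m (conjugate T f)) (∏ i, Φ i) :=
    dvd_lieDeriv_prod _ fun i => dvd_lieDeriv_homogenizeVF hdeg (hχ0 i)
      (dvd_lieDeriv_conjugate hT (hsemi i).dvd)
  have hz1 : (setFirstOne Z).IsHomogeneous 1 := by
    obtain ⟨k, hk⟩ := Fin.exists_succ_eq.mpr (show Fin.last n ≠ 0 by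
      rw [Ne, Fin.ext_iff]; simpa using hn0.ne')
    have : setFirstOne Z = X k := by
      change setFirstOne (X (Fin.last n)) = _
      rw [← hk, setFirstOne_eq_substAt, ← Fin.succAbove_zero_apply, substAt_X_succAbove]
    rw [this]
    exact isHomogeneous_X _ _
  set ρ := rename (R := ℂ) (Fin.last n).succAbove
  obtain ⟨W, hW⟩ := X_dvd_sub_rename_substAt (Fin.last n) (∏ i, Φ i)
  -- Setting x_{n+1} = 0 in a homogenization leaves the highest degree part, so modulo Z the product
  -- is that of the transformed highest degree parts.
  have hdec : ∏ i, Φ i = ρ (linSub T⁻¹ ψ) * ρ (linSub T⁻¹ ψ) * ρ (linSub T⁻¹ S) + Z * W := by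
    have h1 : substAt (Fin.last n) 0 (∏ i, Φ i) = linSub T⁻¹ (∏ i, topPart (φ i)) := by
      rw [map_prod, map_prod]
      exact Finset.prod_congr rfl fun i _ => by
        rw [substAt_zero_homAt, ← topPart_linSub hT']; rfl
    rw [h1, hS', sub_eq_iff_eq_add] at hW
    refine hW.trans ?_
    simp only [map_mul]
    exact add_comm _ _
  refine not_squarefree_of_eigCond hstat (hE v hv T hT hTv hstat)
    (dvd_lieDeriv_poincareE1 (isHomogeneous_X ℂ _) hZd) hz1
    (dvd_lieDeriv_poincareE1 hPhom hPd)
    (q := setFirstOne (ρ (linSub T⁻¹ ψ))) (S := setFirstOne (ρ (linSub T⁻¹ S)))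
    (W := setFirstOne W) ?_ ?_ hsq'
  · rw [hdec]
    simp only [setFirstOne_eq_substAt, map_add, map_mul]
    rfl
  · rw [eval_zero_setFirstOne_rename hn0, eval_linSub, hTe, hvψ]

/-! ### Factorizations into the ψⱼ and degree counts -/

theorem exists_associated_prod_pow {R : Type*} [CommRing R] [IsDomain R]
    [UniqueFactorizationMonoid R] {l : ℕ} (ψ : Fin l → R) (x : R) (hx : x ≠ 0)
    (h : ∀ χ, Irreducible χ → χ ∣ x → ∃ j, Associated χ (ψ j)) :
    ∃ k : Fin l → ℕ, Associated x (∏ j, ψ j ^ k j) := by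
  induction x using UniqueFactorizationMonoid.induction_on_prime with
  | h₁ => exact absurd rfl hx
  | h₂ x hu => exact ⟨0, by simpa [associated_one_iff_isUnit] using hu⟩
  | h₃ a p ha hp ih =>
    obtain ⟨k, hk⟩ := ih ha fun χ hχ hd => h χ hχ (Dvd.dvd.mul_left hd p)
    obtain ⟨j, hj⟩ := h p hp.irreducible (dvd_mul_right p a)
    refine ⟨k + Pi.single j 1, ?_⟩
    have : ∏ i, ψ i ^ (k + Pi.single j 1 : Fin l → ℕ) i = ψ j * ∏ i, ψ i ^ k i := by
      simp only [Pi.add_apply, pow_add, Finset.prod_mul_distrib]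
      rw [Finset.prod_eq_single (f := fun i => ψ i ^ (Pi.single j 1 : Fin l → ℕ) i) j
        (fun i _ hi => by simp [hi]) (by simp)]
      simp [mul_comm]
    rw [this]
    exact hj.mul_mul hk

theorem exists_isTopFactorization {s l : ℕ} {φ : Fin s → MvPolynomial (Fin n) ℂ}
    (hφ : ∀ i, φ i ≠ 0) {ψ : Fin l → MvPolynomial (Fin n) ℂ}
    (h : ∀ i χ, Irreducible χ → χ ∣ topPart (φ i) → ∃ j, Associated χ (ψ j)) :
    ∃ k : Fin s → Fin l → ℕ, IsTopFactorization φ ψ k := by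
  choose k hk using fun i => exists_associated_prod_pow ψ (topPart (φ i))
    (topPart_ne_zero (hφ i)) (h i)
  refine ⟨k, fun i => ?_⟩
  obtain ⟨u, hu⟩ := (hk i).symm
  obtain ⟨c, hc, hcu⟩ := MvPolynomial.isUnit_iff_eq_C_of_isReduced.mp u.isUnit
  exact ⟨c, hc.ne_zero, by rw [← hu, hcu, mul_comm]⟩

theorem IsTopFactorization.pow_dvd {s l : ℕ} {φ : Fin s → MvPolynomial (Fin n) ℂ}
    {ψ : Fin l → MvPolynomial (Fin n) ℂ} {k : Fin s → Fin l → ℕ} (h : IsTopFactorization φ ψ k)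
    (i : Fin s) (j : Fin l) : ψ j ^ k i j ∣ topPart (φ i) := by
  obtain ⟨c, -, hc⟩ := h i
  rw [hc]
  exact Dvd.dvd.mul_left (Finset.dvd_prod_of_mem (fun j => ψ j ^ k i j) (Finset.mem_univ j)) _

theorem IsTopFactorization.sum_le_one (hn : 2 ≤ n) {m : ℕ} {f : VField n} (hf : HasDegree f m)
    (hE : PropertyE f m) (hS : PropertyS f m) {s : ℕ} {φ : Fin s → MvPolynomial (Fin n) ℂ}
    (hirr : ∀ i, Irreducible (φ i)) (hsemi : ∀ i, IsSemiInvariant f (φ i))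
    (hprime : ∀ i i', i ≠ i' → IsRelPrime (φ i) (φ i')) {l : ℕ}
    {ψ : Fin l → MvPolynomial (Fin n) ℂ} {k : Fin s → Fin l → ℕ} (h : IsTopFactorization φ ψ k)
    (j : Fin l) (hψ : Irreducible (ψ j)) : ∑ i, k i j ≤ 1 := by
  by_contra hlt
  obtain ⟨i₀, -, hi₀⟩ := Finset.exists_ne_zero_of_sum_ne_zero
    (show ∑ i, k i j ≠ 0 by lia)
  refine not_sq_dvd_prod_topPart hn hf hE hS hirr hsemi hprime hψ
    ((dvd_pow_self _ hi₀).trans (h.pow_dvd i₀ j)) ?_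
  have h1 : ∏ i, ψ j ^ k i j ∣ ∏ i, topPart (φ i) :=
    Finset.prod_dvd_prod_of_dvd _ _ fun i _ => h.pow_dvd i j
  rw [Finset.prod_pow_eq_pow_sum] at h1
  rw [← sq]
  exact (pow_dvd_pow _ (by lia)).trans h1

theorem totalDegree_prod_pow {l : ℕ} {ψ : Fin l → MvPolynomial (Fin n) ℂ} (hψ : ∀ j, ψ j ≠ 0)
    (k : Fin l → ℕ) (t : Finset (Fin l)) :
    (∏ j ∈ t, ψ j ^ k j).totalDegree = ∑ j ∈ t, k j * (ψ j).totalDegree := by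
  simp only [← natDegree_scale, map_prod, map_pow]
  rw [Polynomial.natDegree_prod _ _ fun j _ => pow_ne_zero _ (scale_ne_zero (hψ j))]
  exact Finset.sum_congr rfl fun j _ => Polynomial.natDegree_pow _ _

theorem IsTopFactorization.totalDegree_eq {s l : ℕ} {φ : Fin s → MvPolynomial (Fin n) ℂ}
    (hφ : ∀ i, φ i ≠ 0) {ψ : Fin l → MvPolynomial (Fin n) ℂ} (hψ : ∀ j, ψ j ≠ 0)
    {k : Fin s → Fin l → ℕ} (h : IsTopFactorization φ ψ k) (i : Fin s) :
    (φ i).totalDegree = ∑ j, k i j * (ψ j).totalDegree := by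
  obtain ⟨c, hc, hφc⟩ := h i
  have h1 := (topPart_isHomogeneous (φ i)).totalDegree (topPart_ne_zero (hφ i))
  rw [← h1, hφc, totalDegree_mul_of_isDomain (by simpa using hc)
    (Finset.prod_ne_zero_iff.mpr fun j _ => pow_ne_zero _ (hψ j)), totalDegree_C, zero_add,
    totalDegree_prod_pow hψ]

theorem exists_isTopFactorization_of_semiInvariantList {m : ℕ} {f : VField n}
    (hf : HasDegree f m) {s : ℕ} {φ : Fin s → MvPolynomial (Fin n) ℂ}
    (hirr : ∀ i, Irreducible (φ i)) (hsemi : ∀ i, IsSemiInvariant f (φ i)) {l : ℕ}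
    {ψ : Fin l → MvPolynomial (Fin n) ℂ} (hψ : IsIrredSemiInvariantList (homPart m f) ψ) :
    ∃ k : Fin s → Fin l → ℕ, IsTopFactorization φ ψ k :=
  exists_isTopFactorization (fun i => (hirr i).ne_zero) fun i χ hχ hd =>
    hψ.2.2 χ hχ (isSemiInvariant_of_irreducible hχ
      (dvd_lieDeriv_of_dvd_topPart hf.1 (hirr i).ne_zero (hsemi i) hχ hd))

theorem sum_totalDegree_le (hn : 2 ≤ n) {m : ℕ} {f : VField n} (hf : HasDegree f m)
    (hE : PropertyE f m) (hS : PropertyS f m) {s : ℕ} {φ : Fin s → MvPolynomial (Fin n) ℂ}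
    (hirr : ∀ i, Irreducible (φ i)) (hsemi : ∀ i, IsSemiInvariant f (φ i))
    (hprime : ∀ i i', i ≠ i' → IsRelPrime (φ i) (φ i')) {l : ℕ}
    {ψ : Fin l → MvPolynomial (Fin n) ℂ} (hψ : IsIrredSemiInvariantList (homPart m f) ψ) :
    ∑ i, (φ i).totalDegree ≤ ∑ j, (ψ j).totalDegree := by
  obtain ⟨k, hk⟩ := exists_isTopFactorization_of_semiInvariantList hf hirr hsemi hψ
  rw [Finset.sum_congr rfl fun i _ => hk.totalDegree_eq (fun i => (hirr i).ne_zero)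
    (fun j => (hψ.1 j).1.ne_zero) i, Finset.sum_comm]
  refine Finset.sum_le_sum fun j _ => ?_
  rw [← Finset.sum_mul]
  exact (Nat.mul_le_mul_right _
    (hk.sum_le_one hn hf hE hS hirr hsemi hprime j (hψ.1 j).1)).trans (one_mul _).le

theorem finite_irreducible_semiInvariants (hn : 2 ≤ n) {m : ℕ} {f : VField n}
    (hf : HasDegree f m) (hE : PropertyE f m) (hS : PropertyS f m) {l : ℕ}
    {ψ : Fin l → MvPolynomial (Fin n) ℂ} (hψ : IsIrredSemiInvariantList (homPart m f) ψ) :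
    {a : Associates (MvPolynomial (Fin n) ℂ) |
      ∃ χ, Irreducible χ ∧ IsSemiInvariant f χ ∧ Associates.mk χ = a}.Finite := by
  by_contra hinf
  -- One class more than the degree bound allows, since each semi-invariant has degree at least 1;
  -- distinct classes of irreducibles are relatively prime.
  obtain ⟨t, ht, hcard⟩ := Set.Infinite.exists_subset_card_eq hinf (∑ j, (ψ j).totalDegree + 1)
  let e := (Finset.equivFinOfCardEq hcard).symm
  choose χ hχ using fun i => ht (e i).2
  have hrel : ∀ i i', i ≠ i' → IsRelPrime (χ i) (χ i') := fun i i' hii => by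
    rw [(hχ i).1.isRelPrime_iff_not_dvd]
    intro hd
    have h1 := Associates.mk_eq_mk_iff_associated.mpr ((hχ i).1.associated_of_dvd (hχ i').1 hd)
    rw [(hχ i).2.2, (hχ i').2.2] at h1
    exact hii (e.injective (Subtype.ext h1))
  have h1 := sum_totalDegree_le hn hf hE hS (fun i => (hχ i).1) (fun i => (hχ i).2.1) hrel hψ
  have h2 := Finset.sum_le_sum fun i (_ : i ∈ Finset.univ) => (hχ i).2.1.one_le_totalDegree
  simp only [Finset.sum_const, Finset.card_univ, Fintype.card_fin, smul_eq_mul, mul_one] at h2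
  lia

end Main
end PolyVF

/-! ### The theorem -/

theorem mainTheorem2 (n : ℕ) (hn : 2 ≤ n) (m : ℕ) (f : PolyVF.VField n)
    (hf : PolyVF.HasDegree f m) (hE : PolyVF.PropertyE f m) (hS : PolyVF.PropertyS f m)
    (s : ℕ) (φ : Fin s → MvPolynomial (Fin n) ℂ)
    (hirr : ∀ i, Irreducible (φ i)) (hsemi : ∀ i, PolyVF.IsSemiInvariant f (φ i))
    (hprime : ∀ i i', i ≠ i' → IsRelPrime (φ i) (φ i')) :
    (∀ (l : ℕ) (ψ : Fin l → MvPolynomial (Fin n) ℂ), PolyVF.IsTopFactorList φ ψ →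
      (∀ j, (∃ d, (ψ j).IsHomogeneous d) ∧
        PolyVF.IsSemiInvariant (PolyVF.homPart m f) (ψ j)) ∧
      (∃ k : Fin s → Fin l → ℕ, PolyVF.IsTopFactorization φ ψ k) ∧
      ∀ k : Fin s → Fin l → ℕ, PolyVF.IsTopFactorization φ ψ k →
        (∀ j, ∑ i, k i j ≤ 1) ∧
        ∀ i j, ψ j ∣ PolyVF.topPart (φ i) →
          k i j = 1 ∧ ∀ i', i' ≠ i → ¬ ψ j ∣ PolyVF.topPart (φ i')) ∧
    (∀ (l : ℕ) (ψ : Fin l → MvPolynomial (Fin n) ℂ),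
      PolyVF.IsIrredSemiInvariantList (PolyVF.homPart m f) ψ →
      (∃ k : Fin s → Fin l → ℕ, PolyVF.IsTopFactorization φ ψ k) ∧
      (∀ k : Fin s → Fin l → ℕ, PolyVF.IsTopFactorization φ ψ k →
        ∀ i, (φ i).totalDegree = ∑ j, k i j * (ψ j).totalDegree) ∧
      ∑ i, (φ i).totalDegree ≤ ∑ j, (ψ j).totalDegree ∧
      {a : Associates (MvPolynomial (Fin n) ℂ) |
        ∃ χ, Irreducible χ ∧ PolyVF.IsSemiInvariant f χ ∧ Associates.mk χ = a}.Finite) := by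
  refine ⟨fun l ψ hψ => ⟨fun j => ?_, ?_, fun k hk => ⟨fun j => ?_, fun i j hij => ?_⟩⟩,
    fun l ψ hψ => ⟨PolyVF.exists_isTopFactorization_of_semiInvariantList hf hirr hsemi hψ,
      fun k hk => hk.totalDegree_eq (fun i => (hirr i).ne_zero) fun j => (hψ.1 j).1.ne_zero,
      PolyVF.sum_totalDegree_le hn hf hE hS hirr hsemi hprime hψ,
      PolyVF.finite_irreducible_semiInvariants hn hf hE hS hψ⟩⟩
  · obtain ⟨i, hi⟩ := hψ.2.2.1 j
    exact ⟨PolyVF.isHomogeneous_of_dvd (PolyVF.topPart_isHomogeneous _)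
      (PolyVF.topPart_ne_zero (hirr i).ne_zero) hi,
      PolyVF.isSemiInvariant_of_irreducible (hψ.1 j)
        (PolyVF.dvd_lieDeriv_of_dvd_topPart hf.1 (hirr i).ne_zero (hsemi i) (hψ.1 j) hi)⟩
  · exact PolyVF.exists_isTopFactorization (fun i => (hirr i).ne_zero)
      fun i χ hχ hd => hψ.2.2.2 χ hχ ⟨i, hd⟩
  · exact hk.sum_le_one hn hf hE hS hirr hsemi hprime j (hψ.1 j)
  · have hle := hk.sum_le_one hn hf hE hS hirr hsemi hprime j (hψ.1 j)
    -- With exponent 0, the prime ψⱼ would divide some other ψⱼ', against relative primality.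
    have hkij : k i j ≠ 0 := fun h0 => by
      obtain ⟨c, hc, hφc⟩ := hk i
      have hpr := (hψ.1 j).prime
      rw [hφc] at hij
      rcases hpr.dvd_or_dvd hij with h | h
      · exact (hψ.1 j).not_isUnit (isUnit_of_dvd_unit h (hc.isUnit.map C))
      · obtain ⟨j', -, hj'⟩ := (Prime.dvd_finsetProd_iff hpr _).mp h
        by_cases hjj : j' = j
        · rw [hjj, h0, pow_zero] at hj'
          exact (hψ.1 j).not_isUnit (isUnit_of_dvd_one hj')
        · exact (hψ.1 j).not_isUnit
            (hψ.2.1 j j' (Ne.symm hjj) dvd_rfl (hpr.dvd_of_dvd_pow hj'))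
    refine ⟨?_, fun i' hi' hd => ?_⟩
    · have := Finset.single_le_sum (f := fun i => k i j) (fun _ _ => Nat.zero_le _)
        (Finset.mem_univ i)
      lia
    · refine PolyVF.not_sq_dvd_prod_topPart hn hf hE hS hirr hsemi hprime (hψ.1 j) hij ?_
      refine (mul_dvd_mul hij hd).trans ?_
      rw [← Finset.prod_pair (f := fun i => PolyVF.topPart (φ i)) (Ne.symm hi')]
      exact Finset.prod_dvd_prod_of_subset _ _ _ (Finset.subset_univ _)
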